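/- Let $G$ be a Lie group acting smoothly on the left on a connected smooth manifold $M$. A $G$-equivariant $U(1)$-bundle over $M$ is a smooth principal $U(1)$-bundle $p\colon P\to M$ with a smooth left action of $G$ on $P$ by principal bundle automorphisms $\phi_P$ ($\phi\in G$) covering the given action $\phi_M$ of $G$ on $M$. Let $(P,\Xi)$ and $(P',\Xi')$ be two $G$-equivariant $U(1)$-bundles over $M$ with $G$-invariant connections, where a connection is regarded as its connection form $\Xi\in\Omega^1(P,i\mathbb{R})$. For $\phi\in G$ let $$\mathcal{C}^{\phi}(M)=\{\gamma\colon[0,1]\to M \mid \gamma\text{ is piecewise }C^1\text{ and }\gamma(1)=\phi_M(\gamma(0))\}.$$ For $\gamma\in\mathcal{C}^{\phi}(M)$ and $y\in p^{-1}(\gamma(0))$ let $\overline{\gamma}^{\,y}\colon[0,1]\to P$ be the $\Xi$-horizontal lift of $\gamma$ with $\overline{\gamma}^{\,y}(0)=y$. The equivariant holonomy $\mathrm{Hol}^{\Xi}_{\phi}(\gamma)\in U(1)$ is the element, independent of $y$, characterized by $$\overline{\gamma}^{\,y}(1)=\phi_P(y)\cdot\mathrm{Hol}^{\Xi}_{\phi}(\gamma).$$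 Then the following are equivalent: 1. there is an isomorphism of principal $U(1)$-bundles $\Phi\colon P'\to P$ covering $\mathrm{id}_M$ which is $G$-equivariant and satisfies $\Phi^{*}\Xi=\Xi'$; 2. $\mathrm{Hol}^{\Xi}_{\phi}(\gamma)=\mathrm{Hol}^{\Xi'}_{\phi}(\gamma)$ for every $\phi\in G$ and every $\gamma\in\mathcal{C}^{\phi}(M)$. -/

import Mathlib

open Set
open scoped Manifold ContDiff

noncomputable section

namespace EquivariantHolonomy

/-! Throughout, `U(1)` is `Circle`. As `U(1)` is abelian, its right action on a principal bundle is
written as a left action: `u • y` stands for `y · u`. Smooth means `C^∞`. -/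

section Bundles

variable {E : Type*} [NormedAddCommGroup E] [NormedSpace ℝ E]
  {H : Type*} [TopologicalSpace H] (I : ModelWithCorners ℝ E H)
  {M : Type*} [TopologicalSpace M] [ChartedSpace H M]
  {EP : Type*} [NormedAddCommGroup EP] [NormedSpace ℝ EP]
  {HP : Type*} [TopologicalSpace HP] (IP : ModelWithCorners ℝ EP HP)
  {P : Type*} [TopologicalSpace P] [ChartedSpace HP P] [MulAction Circle P]
  {EG : Type*} [NormedAddCommGroup EG] [NormedSpace ℝ EG]
  {HG : Type*} [TopologicalSpace HG] (IG : ModelWithCorners ℝ EG HG)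

/-- `p : P → M`, with the given action of `U(1)` on `P`, is a smooth principal `U(1)`-bundle:
the action is smooth and preserves the fibres, and around every point of `M` there is a smooth
`U(1)`-equivariant local trivialization `p ⁻¹' U ≃ U × U(1)`. (These imply that `p` is surjective
and that `U(1)` acts freely and transitively on each fibre.) -/
structure IsPrincipalCircleBundle (p : P → M) : Prop where
  contMDiff_proj : ContMDiff IP I ∞ p
  contMDiff_smul : ContMDiff ((𝓡 1).prod IP) IP ∞ (fun q : Circle × P => q.1 • q.2)
  proj_smul : ∀ (u : Circle) (y : P), p (u • y) = p y
  exists_trivialization : ∀ x : M, ∃ e : Bundle.Trivialization Circle p,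
    x ∈ e.baseSet ∧
    ContMDiffOn IP (I.prod (𝓡 1)) ∞ e e.source ∧
    ContMDiffOn (I.prod (𝓡 1)) IP ∞ e.toOpenPartialHomeomorph.symm e.target ∧
    ∀ y ∈ e.source, ∀ u : Circle, (e (u • y)).2 = (e y).2 * u

/-- `p : P → M` is a `G`-equivariant `U(1)`-bundle: a principal `U(1)`-bundle on which the Lie
group `G` acts smoothly by principal bundle automorphisms covering the action of `G` on `M`. -/
structure IsEquivariantCircleBundle (G : Type*) [Group G] [TopologicalSpace G] [ChartedSpace HG G]
    [MulAction G M] [MulAction G P] (p : P → M) : Prop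
    extends IsPrincipalCircleBundle I IP p where
  contMDiff_group_smul : ContMDiff (IG.prod IP) IP ∞ (fun q : G × P => q.1 • q.2)
  proj_group_smul : ∀ (g : G) (y : P), p (g • y) = g • p y
  smul_comm : ∀ (g : G) (u : Circle) (y : P), g • (u • y) = u • (g • y)

/-- Smoothness of a complex valued differential `1`-form on `P`: it is smooth as a (fibrewise
linear) function on the tangent bundle. -/
def IsSmoothForm [IsManifold IP ∞ P] (Ξ : (y : P) → TangentSpace IP y →L[ℝ] ℂ) : Prop :=
  ContMDiff IP.tangent 𝓘(ℝ, ℂ) ∞ (fun v : TangentBundle IP P => Ξ v.1 v.2)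

/-- `Ξ` is a connection form on the principal `U(1)`-bundle `P`: a smooth `1`-form with values in
`iℝ`, invariant under `U(1)`, and with value `i` on the fundamental vector field of `i`, i.e. on
the velocity at `t = 0` of `t ↦ y · exp (i t)`. -/
structure IsConnectionForm [IsManifold IP ∞ P] (Ξ : (y : P) → TangentSpace IP y →L[ℝ] ℂ) :
    Prop where
  smooth : IsSmoothForm IP Ξ
  imaginary : ∀ (y : P) (v : TangentSpace IP y), (Ξ y v).re = 0
  invariant : ∀ (u : Circle) (y : P) (v : TangentSpace IP y),
    Ξ (u • y) (mfderiv IP IP (fun z : P => u • z) y v) = Ξ y v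
  vertical : ∀ y : P,
    Ξ (Circle.exp 0 • y) (mfderiv 𝓘(ℝ, ℝ) IP (fun t : ℝ => Circle.exp t • y) 0 (1 : ℝ)) = Complex.I

/-- `Ξ` is a `G`-invariant connection form on `P`. -/
structure IsInvariantConnectionForm (G : Type*) [Group G] [MulAction G P] [IsManifold IP ∞ P]
    (Ξ : (y : P) → TangentSpace IP y →L[ℝ] ℂ) : Prop extends IsConnectionForm IP Ξ where
  group_invariant : ∀ (g : G) (y : P) (v : TangentSpace IP y),
    Ξ (g • y) (mfderiv IP IP (fun z : P => g • z) y v) = Ξ y v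

end Bundles

section Curves

variable {E : Type*} [NormedAddCommGroup E] [NormedSpace ℝ E]
  {H : Type*} [TopologicalSpace H] (I : ModelWithCorners ℝ E H)
  {M : Type*} [TopologicalSpace M] [ChartedSpace H M]
  {EP : Type*} [NormedAddCommGroup EP] [NormedSpace ℝ EP]
  {HP : Type*} [TopologicalSpace HP] (IP : ModelWithCorners ℝ EP HP)
  {P : Type*} [TopologicalSpace P] [ChartedSpace HP P] [MulAction Circle P]

/-- `γ` is piecewise `C¹` on `[0,1]`: for some `0 = t₀ ≤ t₁ ≤ ⋯ ≤ tₙ = 1` it is `C¹` on every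
`[tᵢ, tᵢ₊₁]`. (Continuity on `[0,1]` follows.) A curve `[0,1] → M` is represented by a function
`ℝ → M`, of which only the restriction to `[0,1]` is used. -/
def IsPiecewiseC1 (γ : ℝ → M) : Prop :=
  ∃ (n : ℕ) (t : ℕ → ℝ), Monotone t ∧ t 0 = 0 ∧ t n = 1 ∧
    ∀ i < n, ContMDiffOn 𝓘(ℝ, ℝ) I 1 γ (Icc (t i) (t (i + 1)))

/-- The set `C^φ(M)` of piecewise `C¹` curves `γ` with `γ(1) = φ_M(γ(0))`. -/
def twistedLoops {G : Type*} [Group G] [MulAction G M] (φ : G) : Set (ℝ → M) :=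
  {γ | IsPiecewiseC1 I γ ∧ γ 1 = φ • γ 0}

/-- `γbar` is a `Ξ`-horizontal lift of `γ`: a piecewise `C¹` curve over `γ` whose velocity, wherever
it exists, is annihilated by `Ξ`. -/
structure IsHorizontalLift (p : P → M) (Ξ : (y : P) → TangentSpace IP y →L[ℝ] ℂ)
    (γ : ℝ → M) (γbar : ℝ → P) : Prop where
  piecewiseC1 : IsPiecewiseC1 IP γbar
  proj_eq : ∀ t ∈ Icc (0 : ℝ) 1, p (γbar t) = γ t
  horizontal : ∀ t ∈ Ioo (0 : ℝ) 1, MDifferentiableAt 𝓘(ℝ, ℝ) IP γbar t →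
    Ξ (γbar t) (mfderiv 𝓘(ℝ, ℝ) IP γbar t (1 : ℝ)) = 0

/-- The equivariant holonomy `Hol_φ^Ξ(γ) ∈ U(1)` of `γ ∈ C^φ(M)`: the element `u` with
`γbar(1) = φ_P(γbar(0)) · u` for a horizontal lift `γbar` of `γ`. (A horizontal lift exists through
each point over `γ(0)`, and `u` is the same for all of them.) -/
def equivariantHolonomy {G : Type*} [Group G] [MulAction G P] (p : P → M)
    (Ξ : (y : P) → TangentSpace IP y →L[ℝ] ℂ) (φ : G) (γ : ℝ → M) : Circle :=
  Classical.epsilon fun u : Circle =>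
    ∃ γbar : ℝ → P, IsHorizontalLift IP p Ξ γ γbar ∧ γbar 1 = u • (φ • γbar 0)

end Curves

section Isomorphisms

variable {M : Type*}
  {EP : Type*} [NormedAddCommGroup EP] [NormedSpace ℝ EP]
  {HP : Type*} [TopologicalSpace HP] (IP : ModelWithCorners ℝ EP HP)
  {P : Type*} [TopologicalSpace P] [ChartedSpace HP P] [MulAction Circle P]
  {EP' : Type*} [NormedAddCommGroup EP'] [NormedSpace ℝ EP']
  {HP' : Type*} [TopologicalSpace HP'] (IP' : ModelWithCorners ℝ EP' HP')
  {P' : Type*} [TopologicalSpace P'] [ChartedSpace HP' P'] [MulAction Circle P']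

/-- `(P, Ξ) ≃_G (P', Ξ')`: there is a diffeomorphism `Φ : P' → P` covering the identity of `M`,
equivariant for `U(1)` and for `G`, such that `Φ^* Ξ = Ξ'`. -/
def EquivariantlyIsomorphic (G : Type*) [Group G] [MulAction G P] [MulAction G P']
    (p : P → M) (Ξ : (y : P) → TangentSpace IP y →L[ℝ] ℂ)
    (p' : P' → M) (Ξ' : (y : P') → TangentSpace IP' y →L[ℝ] ℂ) : Prop :=
  ∃ Φ : P' ≃ₘ^∞⟮IP', IP⟯ P,
    (∀ y, p (Φ y) = p' y) ∧
    (∀ (u : Circle) (y : P'), Φ (u • y) = u • Φ y) ∧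
    (∀ (g : G) (y : P'), Φ (g • y) = g • Φ y) ∧
    ∀ (y : P') (v : TangentSpace IP' y), Ξ (Φ y) (mfderiv IP' IP Φ y v) = Ξ' y v

end Isomorphisms

end EquivariantHolonomy

end

/-! Multiplying a curve in `P` by `exp (iθ)` changes the value of the connection form on its
velocity by `iθ'` (`formAlong_gauge`). As `U(1)` is abelian, horizontality is therefore a matter of
integration (`exists_gauge_horizontal`), and two horizontal lifts of one curve differ by a constant.

An isomorphism matches the horizontal lifts in `P'` with those in `P`, so it preserves holonomy.

Conversely, fix `a₀` and `b₀` over one point of `M` and transport both along the same curves.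
Connectedness makes every fibre reachable. Sending the endpoint in `P'` to the endpoint in `P`, and
extending by `U(1)`, should define `Φ`. If two such transports end at points of `P'` that differ by
`φ` and an element of `U(1)`, running back along one and out along the other gives an element of
`C^φ(M)`. Equality of holonomies makes the endpoints in `P` differ in the same way
(`HorizontalReach.eq_smul`). The case `φ = 1` says that `Φ` is well defined, the general case that
it is `G`-equivariant.

By construction `Φ` commutes with parallel transport; regularity is deduced from this alone. Between
local sections `s'` and `s`, `Φ` is multiplication by a function `F` that satisfies `dF = F ·
(s'^*Ξ' - s^*Ξ)` along lines. Such an `F` is smooth by bootstrapping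
(`contDiff_of_hasDerivAt_line`), and the same equation along `c` and `Φ ∘ c` gives `Φ^*Ξ = Ξ'`. -/

open Set
open scoped Manifold ContDiff

noncomputable section

namespace EquivariantHolonomy

/-! ### Connection forms along curves -/

section FormAlong

variable {EP : Type*} [NormedAddCommGroup EP] [NormedSpace ℝ EP]
  {HP : Type*} [TopologicalSpace HP] (IP : ModelWithCorners ℝ EP HP)
  {P : Type*} [TopologicalSpace P] [ChartedSpace HP P]

/-- The value of the `1`-form `Ξ` on the velocity of the curve `c` at time `t`. -/
def formAlong (Ξ : (y : P) → TangentSpace IP y →L[ℝ] ℂ) (c : ℝ → P) (t : ℝ) : ℂ :=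
  Ξ (c t) (mfderiv 𝓘(ℝ, ℝ) IP c t (1 : ℝ))

variable {IP} {Ξ : (y : P) → TangentSpace IP y →L[ℝ] ℂ}

/-- Every `TangentSpace IP y` unfolds to `EP`, so a vector can be read at either base point without
a cast. -/
theorem form_congr {y z : P} (h : y = z) (v : EP) :
    Ξ y (show TangentSpace IP y from v) = Ξ z (show TangentSpace IP z from v) := by
  subst h; rfl

theorem formAlong_congr {c d : ℝ → P} {t : ℝ} (h : c =ᶠ[nhds t] d) :
    formAlong IP Ξ c t = formAlong IP Ξ d t := by
  unfold formAlong
  rw [h.mfderiv_eq]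
  exact form_congr h.eq_of_nhds _

theorem mfderiv_comp_real {c : ℝ → P} {θ : ℝ → ℝ} {θ' t : ℝ}
    (hc : MDifferentiableAt 𝓘(ℝ, ℝ) IP c (θ t)) (hθ : HasDerivAt θ θ' t) :
    (mfderiv 𝓘(ℝ, ℝ) IP (fun s => c (θ s)) t (1 : ℝ) : EP) =
      θ' • (mfderiv 𝓘(ℝ, ℝ) IP c (θ t) (1 : ℝ) : EP) := by
  have h := mfderiv_comp_apply (I := 𝓘(ℝ, ℝ)) (I' := 𝓘(ℝ, ℝ)) (I'' := IP) t hc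
    hθ.differentiableAt.mdifferentiableAt (1 : ℝ)
  refine h.trans ?_
  rw [mfderiv_eq_fderiv]
  have h2 : (fderiv ℝ θ t (1 : ℝ) : ℝ) = θ' • (1 : ℝ) := by
    simp [hθ.hasFDerivAt.fderiv]
  exact (congrArg (fun w : ℝ => (mfderiv 𝓘(ℝ, ℝ) IP c (θ t) w : EP)) h2).trans
    (map_smul (mfderiv 𝓘(ℝ, ℝ) IP c (θ t)) θ' (1 : ℝ))

theorem formAlong_comp_real {c : ℝ → P} {θ : ℝ → ℝ} {θ' t : ℝ}
    (hc : MDifferentiableAt 𝓘(ℝ, ℝ) IP c (θ t)) (hθ : HasDerivAt θ θ' t) :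
    formAlong IP Ξ (fun s => c (θ s)) t = θ' * formAlong IP Ξ c (θ t) := by
  unfold formAlong
  refine (congrArg (Ξ (c (θ t))) (mfderiv_comp_real hc hθ)).trans ?_
  exact (map_smul (Ξ (c (θ t))) θ' _).trans (Complex.real_smul)

variable [IsManifold IP ∞ P]

theorem continuous_formAlong (hΞ : IsSmoothForm IP Ξ) {c : ℝ → P}
    (hc : ContMDiff 𝓘(ℝ, ℝ) IP 1 c) : Continuous (formAlong IP Ξ c) := by
  have h1 := hc.continuous_tangentMap le_rfl
  have h2 : Continuous (fun t : ℝ => (⟨t, (1 : ℝ)⟩ : TangentBundle 𝓘(ℝ, ℝ) ℝ)) :=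
    (contMDiff_vectorSpace_iff_contDiff (n := 0) (V := fun _ : ℝ => (1 : ℝ))).2
      contDiff_const |>.continuous
  exact hΞ.continuous.comp (h1.comp h2)

variable [MulAction Circle P]

theorem formAlong_smul_const (hΞ : IsConnectionForm IP Ξ) {c : ℝ → P} {t : ℝ} (u : Circle)
    (hu : MDifferentiableAt IP IP (fun z : P => u • z) (c t))
    (hc : MDifferentiableAt 𝓘(ℝ, ℝ) IP c t) :
    formAlong IP Ξ (fun s => u • c s) t = formAlong IP Ξ c t := by
  have h := mfderiv_comp_apply (I := 𝓘(ℝ, ℝ)) (I' := IP) (I'' := IP) t hu hc (1 : ℝ)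
  exact (congrArg (Ξ (u • c t)) h).trans (hΞ.invariant u (c t) _)

/-- The normalization `vertical` concerns time `0` only; the group law `exp t • y = exp (t - s) •
(exp s • y)` moves it to time `s`. -/
theorem formAlong_exp_smul (hΞ : IsConnectionForm IP Ξ)
    (hs : ContMDiff ((𝓡 1).prod IP) IP ∞ (fun q : Circle × P => q.1 • q.2)) (y : P) (s : ℝ) :
    formAlong IP Ξ (fun t => Circle.exp t • y) s = Complex.I := by
  have hd : ∀ z : P, ContMDiff 𝓘(ℝ, ℝ) IP ∞ (fun t : ℝ => Circle.exp t • z) := fun z =>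
    hs.comp (contMDiff_circleExp.prodMk contMDiff_const)
  have h := formAlong_comp_real (Ξ := Ξ) (c := fun t => Circle.exp t • (Circle.exp s • y))
    (θ := fun t => t - s) (θ' := 1) (t := s)
    ((hd _).mdifferentiable (by simp) _) ((hasDerivAt_id s).sub_const s)
  have h0 : formAlong IP Ξ (fun t => Circle.exp t • (Circle.exp s • y)) 0 = Complex.I :=
    hΞ.vertical _
  simp only [sub_self, h0, Complex.ofReal_one, one_mul] at h
  rw [← h]
  congr 1
  funext t
  rw [smul_smul, ← Circle.exp_add, sub_add_cancel]

/-- The value of a connection form on the velocity of a curve rotated by `exp (i θ)`. -/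
theorem formAlong_gauge (hΞ : IsConnectionForm IP Ξ)
    (hs : ContMDiff ((𝓡 1).prod IP) IP ∞ (fun q : Circle × P => q.1 • q.2))
    {c : ℝ → P} {θ : ℝ → ℝ} {θ' t : ℝ}
    (hc : MDifferentiableAt 𝓘(ℝ, ℝ) IP c t) (hθ : HasDerivAt θ θ' t) :
    formAlong IP Ξ (fun s => Circle.exp (θ s) • c s) t =
      θ' * Complex.I + formAlong IP Ξ c t := by
  have hf : ContMDiff (𝓘(ℝ, ℝ).prod IP) IP ∞ (fun q : ℝ × P => Circle.exp q.1 • q.2) :=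
    hs.comp ((contMDiff_circleExp.comp contMDiff_fst).prodMk contMDiff_snd)
  have hfd := (hf.mdifferentiable (by simp)) (θ t, c t)
  have hθd : MDifferentiableAt 𝓘(ℝ, ℝ) 𝓘(ℝ, ℝ) θ t := hθ.differentiableAt.mdifferentiableAt
  have h := mfderiv_comp_apply (I := 𝓘(ℝ, ℝ)) (I' := 𝓘(ℝ, ℝ).prod IP) (I'' := IP) t
    (f := fun s => (θ s, c s)) hfd (hθd.prodMk hc) (1 : ℝ)
  -- The velocity splits into a part from `θ`, which is vertical, and a part from `c` rotated by a
  -- fixed element, to which invariance applies.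
  have h2 := h.trans (mfderiv_prod_eq_add_apply hfd)
  rw [mfderiv_prodMk hθd hc] at h2
  have h3 := (congrArg (Ξ (Circle.exp (θ t) • c t)) h2).trans (map_add _ _ _)
  refine h3.trans ?_
  congr 1
  · have h4 := mfderiv_comp_apply (I := 𝓘(ℝ, ℝ)) (I' := 𝓘(ℝ, ℝ)) (I'' := IP) t
      (g := fun z : ℝ => Circle.exp z • c t) (f := θ)
      ((hs.comp (contMDiff_circleExp.prodMk contMDiff_const)).mdifferentiable (by simp) _)
      hθd (1 : ℝ)
    refine (congrArg (Ξ (Circle.exp (θ t) • c t)) h4.symm).trans ?_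
    refine (formAlong_comp_real (Ξ := Ξ) (c := fun z : ℝ => Circle.exp z • c t)
      ((hs.comp (contMDiff_circleExp.prodMk contMDiff_const)).mdifferentiable (by simp) _)
      hθ).trans ?_
    rw [formAlong_exp_smul hΞ hs]
  · exact hΞ.invariant _ _ _

end FormAlong

/-! ### Circle-valued functions -/

section CircleValued

/-- Division by `v t` moves the value at `t` to `1`, where the principal logarithm is
differentiable. Away from `t` the lift may jump, but `exp (i arg z) = z` holds on the whole circle.
-/
theorem exists_hasDerivAt_circle_lift {v : ℝ → Circle} {t : ℝ}
    (hv : DifferentiableAt ℝ (fun s => (v s : ℂ)) t) :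
    ∃ (θ : ℝ → ℝ) (θ' : ℝ), HasDerivAt θ θ' t ∧ ∀ s, v s = Circle.exp (θ s) := by
  have h1 : DifferentiableAt ℝ (fun s => ((v s / v t : Circle) : ℂ)) t := by
    simp only [Circle.coe_div]
    exact hv.div_const _
  have h2 : DifferentiableAt ℝ (fun s => Complex.log ((v s / v t : Circle) : ℂ)) t :=
    (h1.hasDerivAt.clog_real (by simp)).differentiableAt
  have h3 : DifferentiableAt ℝ (fun s => (Complex.log ((v s / v t : Circle) : ℂ)).im) t :=
    Complex.imCLM.differentiableAt.comp t h2
  refine ⟨fun s => (Complex.log ((v s / v t : Circle) : ℂ)).im + Complex.arg (v t), _,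
    (h3.add_const _).hasDerivAt, fun s => ?_⟩
  rw [Circle.exp_add, Complex.log_im, Circle.exp_arg, Circle.exp_arg, div_mul_cancel]

theorem hasDerivAt_coe_circleExp {θ : ℝ → ℝ} {θ' t : ℝ} (h : HasDerivAt θ θ' t) :
    HasDerivAt (fun s => (Circle.exp (θ s) : ℂ)) (Circle.exp (θ t) * (θ' * Complex.I)) t := by
  simp only [Circle.coe_exp]
  exact (h.ofReal_comp.mul_const Complex.I).cexp

theorem contMDiff_coe_circle : ContMDiff (𝓡 1) 𝓘(ℝ, ℂ) ∞ (fun z : Circle => (z : ℂ)) := by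
  have : Fact (Module.finrank ℝ ℂ = 1 + 1) := ⟨Complex.finrank_real_complex⟩
  exact contMDiff_coe_sphere (n := 1) (E := ℂ)

theorem contMDiff_circle_of_coe {EM : Type*} [NormedAddCommGroup EM] [NormedSpace ℝ EM]
    {HM : Type*} [TopologicalSpace HM] {J : ModelWithCorners ℝ EM HM}
    {N : Type*} [TopologicalSpace N] [ChartedSpace HM N] [IsManifold J ∞ N]
    {f : N → Circle}
    (hf : ContMDiff J 𝓘(ℝ, ℂ) ∞ (fun x => (f x : ℂ))) : ContMDiff J (𝓡 1) ∞ f := by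
  have : Fact (Module.finrank ℝ ℂ = 1 + 1) := ⟨Complex.finrank_real_complex⟩
  exact hf.codRestrict_sphere (n := 1) (E := ℂ) (fun _ => mem_sphere_zero_iff_norm.2 (Circle.norm_coe _))

/-- Expresses the ratio of two curves through fibre coordinates, so that `v`, chosen pointwise,
inherits the regularity of `c` and `d`. -/
theorem eventually_eq_div {M P : Type*} [TopologicalSpace M] [TopologicalSpace P] [MulAction Circle P]
    {p : P → M} {S : Type*} [TopologicalSpace S] {c d : S → P} {v : S → Circle}
    {e : Bundle.Trivialization Circle p} {l : Filter S}
    (he : ∀ y ∈ e.source, ∀ u : Circle, (e (u • y)).2 = (e y).2 * u)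
    (hc : ∀ᶠ s in l, c s ∈ e.source) (hv : ∀ᶠ s in l, d s = v s • c s) :
    v =ᶠ[l] fun s => (e (d s)).2 / (e (c s)).2 := by
  filter_upwards [hc, hv] with s h1 h2
  rw [h2, he _ h1, mul_div_cancel_left]

end CircleValued

/-! ### Fibres, ratios of curves and horizontal gauges -/

namespace IsPrincipalCircleBundle

variable {E : Type*} [NormedAddCommGroup E] [NormedSpace ℝ E]
  {H : Type*} [TopologicalSpace H] {I : ModelWithCorners ℝ E H}
  {M : Type*} [TopologicalSpace M] [ChartedSpace H M]
  {EP : Type*} [NormedAddCommGroup EP] [NormedSpace ℝ EP]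
  {HP : Type*} [TopologicalSpace HP] {IP : ModelWithCorners ℝ EP HP}
  {P : Type*} [TopologicalSpace P] [ChartedSpace HP P] [MulAction Circle P]
  {p : P → M} (hP : IsPrincipalCircleBundle I IP p)

include hP

theorem surjective : Function.Surjective p := fun x => by
  obtain ⟨e, hx, -⟩ := hP.exists_trivialization x
  exact ⟨e.toOpenPartialHomeomorph.symm (x, 1), e.proj_symm_apply' hx⟩

theorem smul_left_injective {u v : Circle} {y : P} (h : u • y = v • y) : u = v := by
  obtain ⟨e, hx, -, -, he⟩ := hP.exists_trivialization (p y)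
  have hy := e.mem_source.2 hx
  have h1 := he y hy u
  rw [h, he y hy v] at h1
  exact (mul_left_cancel h1).symm

theorem exists_smul_eq {y z : P} (h : p y = p z) : ∃ u : Circle, z = u • y := by
  obtain ⟨e, hx, -, -, he⟩ := hP.exists_trivialization (p y)
  have hy := e.mem_source.2 hx
  have hz : z ∈ e.source := e.mem_source.2 (h ▸ hx)
  refine ⟨(e y).2⁻¹ * (e z).2, e.injOn hz (e.mem_source.2 (by rwa [hP.proj_smul])) ?_⟩
  refine Prod.ext ?_ ?_
  · change (e z).1 = (e _).1
    rw [e.coe_fst hz, e.coe_fst (e.mem_source.2 (by rwa [hP.proj_smul])), hP.proj_smul, h]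
  · change (e z).2 = (e _).2
    rw [he y hy, mul_inv_cancel_left]

theorem contMDiff_const_smul (u : Circle) : ContMDiff IP IP ∞ (fun z : P => u • z) :=
  hP.contMDiff_smul.comp (contMDiff_const.prodMk contMDiff_id)

theorem continuousWithinAt_ratio {S : Type*} [TopologicalSpace S] {c d : S → P} {v : S → Circle}
    {A : Set S} {t : S} (hc : ContinuousWithinAt c A t) (hd : ContinuousWithinAt d A t)
    (ht : t ∈ A) (hv : ∀ s ∈ A, d s = v s • c s) : ContinuousWithinAt v A t := by
  obtain ⟨e, hx, -, -, he⟩ := hP.exists_trivialization (p (c t))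
  have hct := e.mem_source.2 hx
  have hdt : d t ∈ e.source := e.mem_source.2 (by rwa [hv t ht, hP.proj_smul])
  have h1 := eventually_eq_div (l := nhdsWithin t A) (v := v) (d := d) he
    (hc.eventually (e.open_source.mem_nhds hct)) (by filter_upwards [self_mem_nhdsWithin] using hv)
  refine ContinuousWithinAt.congr_of_eventuallyEq_of_mem ?_ h1 ht
  have hce := (e.continuousOn_toFun.continuousAt (e.open_source.mem_nhds hct))
  have hde := (e.continuousOn_toFun.continuousAt (e.open_source.mem_nhds hdt))
  exact (hde.comp_continuousWithinAt hd).snd.div' (hce.comp_continuousWithinAt hc).snd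

theorem differentiableAt_ratio {c d : ℝ → P} {v : ℝ → Circle} {t : ℝ}
    (hc : MDifferentiableAt 𝓘(ℝ, ℝ) IP c t) (hd : MDifferentiableAt 𝓘(ℝ, ℝ) IP d t)
    (hv : ∀ᶠ s in nhds t, d s = v s • c s) :
    DifferentiableAt ℝ (fun s => (v s : ℂ)) t := by
  obtain ⟨e, hx, he1, -, he⟩ := hP.exists_trivialization (p (c t))
  have hct := e.mem_source.2 hx
  have hdt : d t ∈ e.source := e.mem_source.2 (by rwa [hv.self_of_nhds, hP.proj_smul])
  have h1 := eventually_eq_div (d := d) he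
    (hc.continuousAt.eventually (e.open_source.mem_nhds hct)) hv
  have key : ∀ {b : ℝ → P}, MDifferentiableAt 𝓘(ℝ, ℝ) IP b t → b t ∈ e.source →
      DifferentiableAt ℝ (fun s => ((e (b s)).2 : ℂ)) t := fun {b} hb hbt => by
    have h2 : MDifferentiableAt IP (I.prod (𝓡 1)) e (b t) :=
      ((he1 _ hbt).contMDiffAt (e.open_source.mem_nhds hbt)).mdifferentiableAt (by simp)
    have h3 := (h2.comp t hb).snd
    exact ((contMDiff_coe_circle.mdifferentiable (by simp) _).comp t h3).differentiableAt
  refine DifferentiableAt.congr_of_eventuallyEq ((key hd hdt).div (key hc hct) (by simp)) ?_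
  filter_upwards [h1] with s hs
  simp [hs]

/-- With `v = exp (iθ)`, this is the gauge formula for `d = exp (iθ) • c`, solved for `iθ'`. -/
theorem hasDerivAt_ratio [IsManifold IP ∞ P] {Ξ : (y : P) → TangentSpace IP y →L[ℝ] ℂ}
    (hΞ : IsConnectionForm IP Ξ) {c d : ℝ → P} {v : ℝ → Circle} {t : ℝ}
    (hc : MDifferentiableAt 𝓘(ℝ, ℝ) IP c t) (hd : MDifferentiableAt 𝓘(ℝ, ℝ) IP d t)
    (hv : ∀ᶠ s in nhds t, d s = v s • c s) :
    HasDerivAt (fun s => (v s : ℂ)) (v t * (formAlong IP Ξ d t - formAlong IP Ξ c t)) t := by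
  obtain ⟨θ, θ', hθ, hθv⟩ := exists_hasDerivAt_circle_lift (hP.differentiableAt_ratio hc hd hv)
  have h1 : formAlong IP Ξ d t = θ' * Complex.I + formAlong IP Ξ c t := by
    rw [← formAlong_gauge hΞ hP.contMDiff_smul hc hθ]
    refine formAlong_congr ?_
    filter_upwards [hv] with s hs
    rw [hs, hθv]
  rw [h1, add_sub_cancel_right]
  simp only [hθv]
  exact hasDerivAt_coe_circleExp hθ

/-- Every `C¹` curve becomes horizontal after multiplication by a suitable circle valued function. -/
theorem exists_gauge_horizontal [IsManifold IP ∞ P] {Ξ : (y : P) → TangentSpace IP y →L[ℝ] ℂ}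
    (hΞ : IsConnectionForm IP Ξ) {c : ℝ → P} (hc : ContMDiff 𝓘(ℝ, ℝ) IP 1 c) :
    ∃ θ : ℝ → ℝ, (∀ t, HasDerivAt θ (-(formAlong IP Ξ c t).im) t) ∧
      ContMDiff 𝓘(ℝ, ℝ) IP 1 (fun t => Circle.exp (θ t) • c t) ∧
      ∀ t, formAlong IP Ξ (fun t => Circle.exp (θ t) • c t) t = 0 := by
  have hcont : Continuous fun t => -(formAlong IP Ξ c t).im :=
    (Complex.continuous_im.comp (continuous_formAlong hΞ.smooth hc)).neg
  -- Since `Ξ` is imaginary, `iθ' + Ξ(c') = 0` is a real equation for `θ'`, solved by an integral.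
  have hθ : ∀ t, HasDerivAt (fun t => ∫ s in (0:ℝ)..t, -(formAlong IP Ξ c s).im)
      (-(formAlong IP Ξ c t).im) t := fun t =>
    intervalIntegral.integral_hasDerivAt_right (hcont.intervalIntegrable _ _)
      (hcont.stronglyMeasurableAtFilter _ _) hcont.continuousAt
  refine ⟨_, hθ, ?_, fun t => ?_⟩
  · have h1 : ContDiff ℝ 1 (fun t => ∫ s in (0:ℝ)..t, -(formAlong IP Ξ c s).im) := by
      rw [contDiff_one_iff_deriv]
      refine ⟨fun t => (hθ t).differentiableAt, ?_⟩
      rw [funext fun t => (hθ t).deriv]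
      exact hcont
    exact (hP.contMDiff_smul.of_le (by simp)).comp
      ((contMDiff_circleExp.comp h1.contMDiff).prodMk hc)
  · rw [formAlong_gauge hΞ hP.contMDiff_smul (hc.mdifferentiable (by simp) t) (hθ t)]
    have h2 : (formAlong IP Ξ c t).re = 0 := hΞ.imaginary _ _
    apply Complex.ext <;> simp [h2]

end IsPrincipalCircleBundle

/-! ### Piecewise `C¹` curves -/

theorem exists_mem_Ico_of_partition {n : ℕ} {t : ℕ → ℝ} {s : ℝ} (h0 : t 0 ≤ s) (hn : s < t n) :
    ∃ i < n, s ∈ Ico (t i) (t (i + 1)) := by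
  induction n with
  | zero => exact absurd hn (not_lt.2 h0)
  | succ k ih =>
    rcases lt_or_ge s (t k) with h | h
    · obtain ⟨i, hi, hs⟩ := ih h
      exact ⟨i, hi.trans (Nat.lt_succ_self k), hs⟩
    · exact ⟨k, Nat.lt_succ_self k, h, hn⟩

namespace IsPiecewiseC1

variable {E : Type*} [NormedAddCommGroup E] [NormedSpace ℝ E]
  {H : Type*} [TopologicalSpace H] {I : ModelWithCorners ℝ E H}
  {M : Type*} [TopologicalSpace M] [ChartedSpace H M] {γ : ℝ → M}

theorem continuousOn (hγ : IsPiecewiseC1 I γ) : ContinuousOn γ (Icc 0 1) := by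
  obtain ⟨n, t, ht, h0, hn, h⟩ := hγ
  have key : ∀ k ≤ n, ContinuousOn γ (Icc (t 0) (t k)) := by
    intro k
    induction k with
    | zero => intro _; rw [Icc_self]; exact continuousOn_singleton _ _
    | succ k ih =>
      intro hk
      rw [← Icc_union_Icc_eq_Icc (ht (Nat.zero_le k)) (ht (Nat.le_succ k))]
      exact (ih (Nat.le_of_succ_le hk)).union_of_isClosed (h k hk).continuousOn isClosed_Icc
        isClosed_Icc
  rw [← h0, ← hn]
  exact key n le_rfl

theorem exists_countable_mdifferentiableAt (hγ : IsPiecewiseC1 I γ) :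
    ∃ S : Set ℝ, S.Countable ∧ ∀ s ∈ Ioo (0 : ℝ) 1 \ S, MDifferentiableAt 𝓘(ℝ, ℝ) I γ s := by
  obtain ⟨n, t, -, h0, hn, h⟩ := hγ
  refine ⟨range t, countable_range t, fun s ⟨hs, hst⟩ => ?_⟩
  obtain ⟨i, hi, h1, h2⟩ := exists_mem_Ico_of_partition (n := n) (t := t) (s := s)
    (h0 ▸ hs.1.le) (hn ▸ hs.2)
  have h3 : t i < s := lt_of_le_of_ne h1 fun h => hst ⟨i, h⟩
  exact ((h i hi s ⟨h1, h2.le⟩).contMDiffAt (Icc_mem_nhds h3 h2)).mdifferentiableAt one_ne_zero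

end IsPiecewiseC1

/-! ### Uniqueness of horizontal lifts and of the holonomy -/

section Holonomy

variable {E : Type*} [NormedAddCommGroup E] [NormedSpace ℝ E]
  {H : Type*} [TopologicalSpace H] {I : ModelWithCorners ℝ E H}
  {M : Type*} [TopologicalSpace M] [ChartedSpace H M]
  {EP : Type*} [NormedAddCommGroup EP] [NormedSpace ℝ EP]
  {HP : Type*} [TopologicalSpace HP] {IP : ModelWithCorners ℝ EP HP}
  {P : Type*} [TopologicalSpace P] [ChartedSpace HP P] [MulAction Circle P] [IsManifold IP ∞ P]
  {p : P → M} {Ξ : (y : P) → TangentSpace IP y →L[ℝ] ℂ}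

/-- Two horizontal lifts of the same curve differ by a constant. -/
theorem IsHorizontalLift.exists_smul_eq (hP : IsPrincipalCircleBundle I IP p)
    (hΞ : IsConnectionForm IP Ξ) {γ : ℝ → M} {c d : ℝ → P}
    (hc : IsHorizontalLift IP p Ξ γ c) (hd : IsHorizontalLift IP p Ξ γ d) :
    ∃ w : Circle, d 0 = w • c 0 ∧ d 1 = w • c 1 := by
  have h : ∀ t, ∃ v : Circle, t ∈ Icc (0 : ℝ) 1 → d t = v • c t := fun t => by
    by_cases ht : t ∈ Icc (0 : ℝ) 1
    · obtain ⟨u, hu⟩ := hP.exists_smul_eq ((hc.proj_eq t ht).trans (hd.proj_eq t ht).symm)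
      exact ⟨u, fun _ => hu⟩
    · exact ⟨1, fun h => absurd h ht⟩
  choose v hv using h
  obtain ⟨S, hS, hcS⟩ := hc.piecewiseC1.exists_countable_mdifferentiableAt
  obtain ⟨S', hS', hdS'⟩ := hd.piecewiseC1.exists_countable_mdifferentiableAt
  have hcont : ContinuousOn (fun t => (v t : ℂ)) (Icc 0 1) := fun t ht =>
    contMDiff_coe_circle.continuous.continuousAt.comp_continuousWithinAt
      (hP.continuousWithinAt_ratio (hc.piecewiseC1.continuousOn t ht)
        (hd.piecewiseC1.continuousOn t ht) ht hv)
  have hder : ∀ t ∈ Ioo (0 : ℝ) 1 \ (S ∪ S'), HasDerivAt (fun t => (v t : ℂ)) 0 t := by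
    rintro t ⟨ht, htS⟩
    have h1 := hcS t ⟨ht, fun h => htS (Or.inl h)⟩
    have h2 := hdS' t ⟨ht, fun h => htS (Or.inr h)⟩
    have h3 := hP.hasDerivAt_ratio hΞ (v := v) h1 h2
      (by filter_upwards [Icc_mem_nhds ht.1 ht.2] with s hs using hv s hs)
    have h4 : formAlong IP Ξ c t = 0 := hc.horizontal t ht h1
    have h5 : formAlong IP Ξ d t = 0 := hd.horizontal t ht h2
    rwa [h4, h5, sub_zero, mul_zero] at h3
  -- The ratio is continuous with derivative zero off the break points, so it has equal values at
  -- `0` and `1`.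
  have hint := MeasureTheory.integral_eq_of_hasDerivAt_off_countable_of_le
    (fun t => (v t : ℂ)) (fun _ => 0) zero_le_one (hS.union hS') hcont hder
    (by simp)
  rw [intervalIntegral.integral_zero] at hint
  have h01 : v 1 = v 0 := Circle.coe_injective (sub_eq_zero.1 hint.symm)
  exact ⟨v 0, hv 0 (by simp), h01 ▸ hv 1 (by simp)⟩

/-- The lift `c` shows that the `epsilon` is realized, perhaps by another lift `d`. The constant
relating `d` to `c` commutes with `φ` and with `U(1)`, so it cancels by freeness of the action. -/
theorem equivariantHolonomy_eq {EG : Type*} [NormedAddCommGroup EG] [NormedSpace ℝ EG]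
    {HG : Type*} [TopologicalSpace HG] {IG : ModelWithCorners ℝ EG HG}
    {G : Type*} [Group G] [TopologicalSpace G] [ChartedSpace HG G] [MulAction G M] [MulAction G P]
    (hP : IsEquivariantCircleBundle I IP IG G p) (hΞ : IsConnectionForm IP Ξ)
    {φ : G} {γ : ℝ → M} {c : ℝ → P} (hc : IsHorizontalLift IP p Ξ γ c) {u : Circle}
    (hu : c 1 = u • (φ • c 0)) : equivariantHolonomy IP p Ξ φ γ = u := by
  obtain ⟨d, hd, hd1⟩ : ∃ d : ℝ → P, IsHorizontalLift IP p Ξ γ d ∧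
      d 1 = equivariantHolonomy IP p Ξ φ γ • (φ • d 0) :=
    Classical.epsilon_spec (p := fun u : Circle => ∃ γbar : ℝ → P,
      IsHorizontalLift IP p Ξ γ γbar ∧ γbar 1 = u • (φ • γbar 0)) ⟨u, c, hc, hu⟩
  obtain ⟨w, h0, h1⟩ := hc.exists_smul_eq hP.toIsPrincipalCircleBundle hΞ hd
  rw [hd1, h0, hu, hP.smul_comm, smul_smul, smul_smul] at h1
  have h2 := hP.toIsPrincipalCircleBundle.smul_left_injective h1
  rw [mul_comm] at h2
  exact mul_left_cancel h2

end Holonomy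

theorem IsPiecewiseC1.contMDiff_comp {E : Type*} [NormedAddCommGroup E] [NormedSpace ℝ E]
    {H : Type*} [TopologicalSpace H] {I : ModelWithCorners ℝ E H}
    {M : Type*} [TopologicalSpace M] [ChartedSpace H M]
    {EP : Type*} [NormedAddCommGroup EP] [NormedSpace ℝ EP]
    {HP : Type*} [TopologicalSpace HP] {IP : ModelWithCorners ℝ EP HP}
    {P : Type*} [TopologicalSpace P] [ChartedSpace HP P] {p : P → M} {c : ℝ → P}
    (hp : ContMDiff IP I 1 p) (hc : IsPiecewiseC1 IP c) : IsPiecewiseC1 I (fun t => p (c t)) := by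
  obtain ⟨n, t, ht, h0, hn, h⟩ := hc
  exact ⟨n, t, ht, h0, hn, fun i hi => hp.comp_contMDiffOn (h i hi)⟩

/-! ### Horizontal curves and their concatenation -/

section GlobalHorizontal

variable {EP : Type*} [NormedAddCommGroup EP] [NormedSpace ℝ EP]
  {HP : Type*} [TopologicalSpace HP] (IP : ModelWithCorners ℝ EP HP)
  {P : Type*} [TopologicalSpace P] [ChartedSpace HP P]

/-- `δ : ℝ → P` is a horizontal `C¹` curve defined for all times. -/
structure IsHorizontalCurve (Ξ : (y : P) → TangentSpace IP y →L[ℝ] ℂ) (δ : ℝ → P) : Prop where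
  contMDiff : ContMDiff 𝓘(ℝ, ℝ) IP 1 δ
  formAlong_eq_zero : ∀ t, formAlong IP Ξ δ t = 0

/-- On the intervals of a partition of `[0,1]`, `c` agrees with horizontal `C¹` curves. -/
def IsPiecewiseHorizontal (Ξ : (y : P) → TangentSpace IP y →L[ℝ] ℂ) (c : ℝ → P) : Prop :=
  ∃ (n : ℕ) (t : ℕ → ℝ), Monotone t ∧ t 0 = 0 ∧ t n = 1 ∧
    ∀ i < n, ∃ δ, IsHorizontalCurve IP Ξ δ ∧ EqOn c δ (Icc (t i) (t (i + 1)))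

/-- The curve that runs through `c` on `[0,1/2]` and through `δ` on `[1/2,1]`, both at double
speed. -/
def concat {X : Type*} (c δ : ℝ → X) (t : ℝ) : X := if t ≤ 1 / 2 then c (2 * t) else δ (2 * t - 1)

theorem concat_zero {X : Type*} (c δ : ℝ → X) : concat c δ 0 = c 0 := by simp [concat]

theorem concat_one {X : Type*} (c δ : ℝ → X) : concat c δ 1 = δ 1 := by
  norm_num [concat]

variable {IP} {Ξ : (y : P) → TangentSpace IP y →L[ℝ] ℂ}

theorem IsHorizontalCurve.comp_affine {δ : ℝ → P} (hδ : IsHorizontalCurve IP Ξ δ) (a b : ℝ) :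
    IsHorizontalCurve IP Ξ (fun t => δ (a * t + b)) where
  contMDiff := hδ.contMDiff.comp
    ((contDiff_const.mul contDiff_id).add contDiff_const : ContDiff ℝ 1 fun t => a * t + b).contMDiff
  formAlong_eq_zero t := by
    rw [formAlong_comp_real (θ := fun t => a * t + b) (θ' := a)
      (hδ.contMDiff.mdifferentiable one_ne_zero _)
      (by simpa using ((hasDerivAt_id t).const_mul a).add_const b), hδ.formAlong_eq_zero, mul_zero]

theorem IsPiecewiseHorizontal.concat {c δ : ℝ → P} (hc : IsPiecewiseHorizontal IP Ξ c)
    (hδ : IsHorizontalCurve IP Ξ δ) (h : c 1 = δ 0) :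
    IsPiecewiseHorizontal IP Ξ (concat c δ) := by
  obtain ⟨n, t, ht, h0, hn, hpc⟩ := hc
  have hle : ∀ i ≤ n, t i ≤ 1 := fun i hi => hn ▸ ht hi
  -- The old partition is squeezed into `[0,1/2]`; its last point becomes `1/2`, and `1` is
  -- appended.
  refine ⟨n + 1, fun i => if i ≤ n then t i / 2 else 1, ?_, by simp [h0], by simp, fun i hi => ?_⟩
  · intro i j hij
    by_cases hj : j ≤ n
    · have := ht hij
      simp only [hij.trans hj, hj, if_true]
      linarith
    · by_cases hi : i ≤ n
      · have := hle i hi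
        simp only [hi, hj, if_true, if_false]
        linarith
      · simp [hi, hj]
  · rcases lt_or_eq_of_le (Nat.lt_succ_iff.1 hi) with hi | rfl
    · obtain ⟨δ', hδ', he⟩ := hpc i hi
      refine ⟨_, hδ'.comp_affine 2 0, fun s hs => ?_⟩
      simp only [hi.le, Nat.succ_le_of_lt hi, if_true] at hs
      have h1 := hle (i + 1) hi
      have h2 : s ≤ 1 / 2 := by linarith [hs.2]
      simp only [EquivariantHolonomy.concat, h2, if_true, add_zero]
      exact he ⟨by linarith [hs.1], by linarith [hs.2]⟩
    · refine ⟨_, hδ.comp_affine 2 (-1), fun s hs => ?_⟩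
      simp only [le_refl, if_true, hn] at hs
      simp only [EquivariantHolonomy.concat, ← sub_eq_add_neg]
      split_ifs with h2
      · have h3 : s = 1 / 2 := le_antisymm h2 hs.1
        subst h3
        norm_num [h]
      · rfl

theorem IsPiecewiseHorizontal.piecewiseC1 {c : ℝ → P} (hc : IsPiecewiseHorizontal IP Ξ c) :
    IsPiecewiseC1 IP c := by
  obtain ⟨n, t, ht, h0, hn, h⟩ := hc
  refine ⟨n, t, ht, h0, hn, fun i hi => ?_⟩
  obtain ⟨δ, hδ, he⟩ := h i hi
  exact hδ.contMDiff.contMDiffOn.congr he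

/-- At a break point `c` agrees with a horizontal curve on one side only. As `c` is assumed
differentiable there, its one-sided derivative along a nondegenerate interval is the full one. -/
theorem IsPiecewiseHorizontal.formAlong_eq_zero {c : ℝ → P} (hc : IsPiecewiseHorizontal IP Ξ c)
    {s : ℝ} (hs : s ∈ Ico (0 : ℝ) 1) (hd : MDifferentiableAt 𝓘(ℝ, ℝ) IP c s) :
    formAlong IP Ξ c s = 0 := by
  obtain ⟨n, t, -, h0, hn, h⟩ := hc
  obtain ⟨i, hi, h1, h2⟩ := exists_mem_Ico_of_partition (n := n) (t := t) (s := s)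
    (h0 ▸ hs.1) (hn ▸ hs.2)
  obtain ⟨δ, hδ, he⟩ := h i hi
  have hsI : s ∈ Icc (t i) (t (i + 1)) := ⟨h1, h2.le⟩
  have hu : UniqueMDiffWithinAt 𝓘(ℝ, ℝ) (Icc (t i) (t (i + 1))) s :=
    (uniqueDiffOn_Icc (h1.trans_lt h2) s hsI).uniqueMDiffWithinAt
  have h3 : mfderiv 𝓘(ℝ, ℝ) IP c s = mfderiv 𝓘(ℝ, ℝ) IP δ s := by
    have h4 := (hδ.contMDiff.mdifferentiable one_ne_zero s).hasMFDerivAt.hasMFDerivWithinAt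
      (s := Icc (t i) (t (i + 1)))
    exact hu.eq hd.hasMFDerivAt.hasMFDerivWithinAt (HasMFDerivWithinAt.congr_mono h4 he (he hsI) Subset.rfl)
  have h5 := hδ.formAlong_eq_zero s
  unfold formAlong at h5 ⊢
  rw [← h5, ← h3]
  exact form_congr (he hsI) _

theorem IsPiecewiseHorizontal.isHorizontalLift {M : Type*} {p : P → M} {γ : ℝ → M} {c : ℝ → P}
    (hc : IsPiecewiseHorizontal IP Ξ c) (hγ : ∀ t ∈ Icc (0 : ℝ) 1, p (c t) = γ t) :
    IsHorizontalLift IP p Ξ γ c :=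
  ⟨hc.piecewiseC1, hγ, fun _ ht hd => hc.formAlong_eq_zero ⟨ht.1.le, ht.2⟩ hd⟩

theorem formAlong_const (y : P) (t : ℝ) : formAlong IP Ξ (fun _ => y) t = 0 := by
  unfold formAlong
  rw [mfderiv_const]
  exact map_zero (Ξ y)

theorem isHorizontalCurve_const (y : P) : IsHorizontalCurve IP Ξ (fun _ => y) :=
  ⟨contMDiff_const, formAlong_const y⟩

theorem isPiecewiseHorizontal_const (y : P) : IsPiecewiseHorizontal IP Ξ (fun _ => y) :=
  ⟨1, fun i => i, Nat.mono_cast, by simp, by simp,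
    fun _ _ => ⟨_, isHorizontalCurve_const y, fun _ _ => rfl⟩⟩

end GlobalHorizontal

theorem IsHorizontalCurve.smul {EP : Type*} [NormedAddCommGroup EP] [NormedSpace ℝ EP]
    {HP : Type*} [TopologicalSpace HP] {IP : ModelWithCorners ℝ EP HP}
    {P : Type*} [TopologicalSpace P] [ChartedSpace HP P] [MulAction Circle P] [IsManifold IP ∞ P]
    {Ξ : (y : P) → TangentSpace IP y →L[ℝ] ℂ} (hΞ : IsConnectionForm IP Ξ) {δ : ℝ → P} {u : Circle}
    (hu : ContMDiff IP IP ∞ (fun z : P => u • z)) (hδ : IsHorizontalCurve IP Ξ δ) :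
    IsHorizontalCurve IP Ξ (fun t => u • δ t) :=
  ⟨(hu.of_le (by simp)).comp hδ.contMDiff, fun t => by
    rw [formAlong_smul_const hΞ u (hu.mdifferentiable (by simp) _)
      (hδ.contMDiff.mdifferentiable one_ne_zero t), hδ.formAlong_eq_zero]⟩

/-! ### Simultaneous transport in both bundles -/

section Reach

variable {M : Type*}
  {EP : Type*} [NormedAddCommGroup EP] [NormedSpace ℝ EP]
  {HP : Type*} [TopologicalSpace HP] (IP : ModelWithCorners ℝ EP HP)
  {P : Type*} [TopologicalSpace P] [ChartedSpace HP P]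
  (p : P → M) (Ξ : (y : P) → TangentSpace IP y →L[ℝ] ℂ)
  {EP' : Type*} [NormedAddCommGroup EP'] [NormedSpace ℝ EP']
  {HP' : Type*} [TopologicalSpace HP'] (IP' : ModelWithCorners ℝ EP' HP')
  {P' : Type*} [TopologicalSpace P'] [ChartedSpace HP' P']
  (p' : P' → M) (Ξ' : (y : P') → TangentSpace IP' y →L[ℝ] ℂ)

/-- The pairs `a` and `b` are the endpoints of a pair of horizontal curves over a common `C¹`
curve. -/
def HorizontalStep (a b : P' × P) : Prop :=
  ∃ (α : ℝ → P') (β : ℝ → P), IsHorizontalCurve IP' Ξ' α ∧ IsHorizontalCurve IP Ξ β ∧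
    (∀ t, p' (α t) = p (β t)) ∧ (α 0, β 0) = a ∧ (α 1, β 1) = b

/-- The pairs `a` and `b` are connected by a chain of pairs of horizontal curves. -/
def HorizontalReach : P' × P → P' × P → Prop :=
  Relation.ReflTransGen (HorizontalStep IP p Ξ IP' p' Ξ')

variable {IP p Ξ IP' p' Ξ'}

theorem HorizontalStep.of_curves {α : ℝ → P'} {β : ℝ → P} (hα : IsHorizontalCurve IP' Ξ' α)
    (hβ : IsHorizontalCurve IP Ξ β) (h : ∀ t, p' (α t) = p (β t)) (s t : ℝ) :
    HorizontalStep IP p Ξ IP' p' Ξ' (α s, β s) (α t, β t) :=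
  ⟨_, _, hα.comp_affine (t - s) s, hβ.comp_affine (t - s) s, fun _ => h _, by simp, by simp⟩

instance : Std.Symm (HorizontalStep IP p Ξ IP' p' Ξ') := ⟨by
  rintro _ _ ⟨α, β, hα, hβ, h, rfl, rfl⟩
  exact HorizontalStep.of_curves hα hβ h 1 0⟩

theorem HorizontalReach.symm {a b : P' × P} (h : HorizontalReach IP p Ξ IP' p' Ξ' a b) :
    HorizontalReach IP p Ξ IP' p' Ξ' b a :=
  Relation.ReflTransGen.stdSymm.symm _ _ h

theorem HorizontalReach.proj_eq {a b : P' × P} (h : HorizontalReach IP p Ξ IP' p' Ξ' a b)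
    (ha : p' a.1 = p a.2) : p' b.1 = p b.2 := by
  induction h with
  | refl => exact ha
  | tail _ h _ =>
    obtain ⟨α, β, -, -, h, -, rfl⟩ := h
    exact h 1

theorem HorizontalReach.exists_curves {a b : P' × P} (h : HorizontalReach IP p Ξ IP' p' Ξ' a b)
    (ha : p' a.1 = p a.2) :
    ∃ (α : ℝ → P') (β : ℝ → P), IsPiecewiseHorizontal IP' Ξ' α ∧ IsPiecewiseHorizontal IP Ξ β ∧
      (∀ t ∈ Icc (0 : ℝ) 1, p' (α t) = p (β t)) ∧ (α 0, β 0) = a ∧ (α 1, β 1) = b := by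
  induction h with
  | refl =>
    exact ⟨_, _, isPiecewiseHorizontal_const a.1, isPiecewiseHorizontal_const a.2, fun _ _ => ha,
      rfl, rfl⟩
  | tail _ hstep ih =>
    obtain ⟨α, β, hα, hβ, h, h0, h1⟩ := ih
    obtain ⟨α', β', hα', hβ', h', h0', h1'⟩ := hstep
    have h2 := Prod.ext_iff.1 (h1.trans h0'.symm)
    refine ⟨concat α α', concat β β', hα.concat hα' h2.1, hβ.concat hβ' h2.2, fun t ht => ?_,
      by rw [concat_zero, concat_zero, h0], by rw [concat_one, concat_one, h1']⟩
    unfold concat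
    split_ifs with h3
    · exact h _ ⟨by linarith [ht.1], by linarith⟩
    · exact h' _

variable [MulAction Circle P] [IsManifold IP ∞ P] [MulAction Circle P'] [IsManifold IP' ∞ P']
  {E : Type*} [NormedAddCommGroup E] [NormedSpace ℝ E]
  {H : Type*} [TopologicalSpace H] {I : ModelWithCorners ℝ E H}
  [TopologicalSpace M] [ChartedSpace H M]

theorem HorizontalReach.smul (hP : IsPrincipalCircleBundle I IP p)
    (hΞ : IsConnectionForm IP Ξ) (hP' : IsPrincipalCircleBundle I IP' p')
    (hΞ' : IsConnectionForm IP' Ξ') {a b : P' × P} (h : HorizontalReach IP p Ξ IP' p' Ξ' a b)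
    (u : Circle) :
    HorizontalReach IP p Ξ IP' p' Ξ' (u • a.1, u • a.2) (u • b.1, u • b.2) := by
  refine Relation.ReflTransGen.lift (fun a : P' × P => (u • a.1, u • a.2)) ?_ _ _ h
  rintro _ _ ⟨α, β, hα, hβ, h, rfl, rfl⟩
  exact ⟨_, _, hα.smul hΞ' (hP'.contMDiff_const_smul u), hβ.smul hΞ (hP.contMDiff_const_smul u),
    fun t => by rw [hP.proj_smul, hP'.proj_smul, h], rfl, rfl⟩

/-- If the holonomies agree then a chain of pairs of horizontal curves that closes up to the action
of `φ` and of `U(1)` in `P'` closes up in the same way in `P`. -/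
theorem HorizontalReach.eq_smul {EG : Type*} [NormedAddCommGroup EG] [NormedSpace ℝ EG]
    {HG : Type*} [TopologicalSpace HG] {IG : ModelWithCorners ℝ EG HG}
    {G : Type*} [Group G] [TopologicalSpace G] [ChartedSpace HG G]
    [MulAction G M] [MulAction G P] [MulAction G P']
    (hP : IsEquivariantCircleBundle I IP IG G p) (hΞ : IsConnectionForm IP Ξ)
    (hP' : IsEquivariantCircleBundle I IP' IG G p') (hΞ' : IsConnectionForm IP' Ξ')
    (hol : ∀ (φ : G), ∀ γ ∈ twistedLoops I φ,
      equivariantHolonomy IP p Ξ φ γ = equivariantHolonomy IP' p' Ξ' φ γ)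
    {a : P'} {b d : P} {u : Circle} {φ : G} (hab : p' a = p b)
    (h : HorizontalReach IP p Ξ IP' p' Ξ' (a, b) (u • (φ • a), d)) : d = u • (φ • b) := by
  obtain ⟨α, β, hα, hβ, hpr, h0, h1⟩ := h.exists_curves hab
  have hd : p d = p (φ • b) := by
    have h2 := h.proj_eq hab
    rw [hP'.proj_smul, hP'.proj_group_smul, hab] at h2
    rw [hP.proj_group_smul, h2]
  obtain ⟨w, rfl⟩ := hP.toIsPrincipalCircleBundle.exists_smul_eq hd.symm
  obtain ⟨rfl, rfl⟩ := Prod.ext_iff.1 h0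
  obtain ⟨hα1, hβ1⟩ := Prod.ext_iff.1 h1
  dsimp only at hα1 hβ1
  have hγ : (fun t => p' (α t)) ∈ twistedLoops I φ := by
    refine ⟨hα.piecewiseC1.contMDiff_comp (hP'.contMDiff_proj.of_le (by simp)), ?_⟩
    dsimp only
    rw [hα1, hP'.proj_smul, hP'.proj_group_smul]
  -- Both curves lift the same twisted loop, with holonomy `u` in `P'` and `w` in `P`.
  have e1 := equivariantHolonomy_eq hP' hΞ'
    (hα.isHorizontalLift (p := p') (γ := fun t => p' (α t)) fun _ _ => rfl) hα1
  have e2 := equivariantHolonomy_eq hP hΞ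
    (hβ.isHorizontalLift (p := p) (γ := fun t => p' (α t)) fun t ht => (hpr t ht).symm) hβ1
  rw [← e1, ← e2, hol φ _ hγ]

end Reach

/-! ### Parametrizations by Euclidean space -/

/-- Around every point of a manifold without boundary there are smooth parametrizations by a
Euclidean space, with image in a prescribed neighbourhood. -/
theorem exists_parametrization {E : Type*} [NormedAddCommGroup E] [NormedSpace ℝ E]
    [FiniteDimensional ℝ E] {H : Type*} [TopologicalSpace H] (I : ModelWithCorners ℝ E H)
    [I.Boundaryless] {N : Type*} [TopologicalSpace N] [ChartedSpace H N] [IsManifold I ∞ N]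
    {W : Set N} (hW : IsOpen W) {x : N} (hx : x ∈ W) :
    ∃ (κ : EuclideanSpace ℝ (Fin (Module.finrank ℝ E)) → N)
      (l : N → EuclideanSpace ℝ (Fin (Module.finrank ℝ E))),
      ContMDiff 𝓘(ℝ, EuclideanSpace ℝ (Fin (Module.finrank ℝ E))) I ∞ κ ∧ IsOpen (range κ) ∧
      range κ ⊆ W ∧ κ 0 = x ∧
      ContMDiffOn I 𝓘(ℝ, EuclideanSpace ℝ (Fin (Module.finrank ℝ E))) ∞ l (range κ) ∧
      ∀ q, l (κ q) = q := by
  let L : E ≃L[ℝ] EuclideanSpace ℝ (Fin (Module.finrank ℝ E)) := toEuclidean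
  let φ := extChartAt I x
  have hT : IsOpen (φ.target ∩ φ.symm ⁻¹' W) :=
    (continuousOn_extChartAt_symm x).isOpen_inter_preimage (isOpen_extChartAt_target x) hW
  have hxT : φ x ∈ φ.target ∩ φ.symm ⁻¹' W :=
    ⟨mem_extChartAt_target x, by simpa [φ] using hx⟩
  obtain ⟨r, hr, hball⟩ := Metric.isOpen_iff.1 (hT.preimage L.symm.continuous) (L (φ x))
    (by simpa using hxT)
  -- Rescaling the whole space onto a ball inside the chart makes every line `q + t • w` available
  -- for all times `t`.
  let b := OpenPartialHomeomorph.univBall (L (φ x)) r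
  have hbt : b.target = Metric.ball (L (φ x)) r := OpenPartialHomeomorph.univBall_target _ hr
  have hbs : b.source = univ := OpenPartialHomeomorph.univBall_source _ r
  have hb : ∀ q, b q ∈ Metric.ball (L (φ x)) r := fun q => hbt ▸ b.map_source (hbs ▸ mem_univ q)
  have hbT : ∀ q, L.symm (b q) ∈ φ.target ∩ φ.symm ⁻¹' W := fun q => hball (hb q)
  have hrange : range (fun q => φ.symm (L.symm (b q))) =
      φ.source ∩ φ ⁻¹' (L ⁻¹' Metric.ball (L (φ x)) r) := by
    ext y
    constructor
    · rintro ⟨q, rfl⟩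
      refine ⟨φ.map_target (hbT q).1, ?_⟩
      simp only [mem_preimage]
      rw [φ.right_inv (hbT q).1, L.apply_symm_apply]
      exact hb q
    · rintro ⟨hy, hy'⟩
      refine ⟨b.symm (L (φ y)), ?_⟩
      dsimp only
      rw [b.right_inv (hbt ▸ hy'), L.symm_apply_apply, φ.left_inv hy]
  refine ⟨fun q => φ.symm (L.symm (b q)), fun y => b.symm (L (φ y)), ?_, ?_, ?_, ?_, ?_, ?_⟩
  · exact (contMDiffOn_extChartAt_symm x).comp_contMDiff
      (L.symm.contDiff.comp OpenPartialHomeomorph.contDiff_univBall).contMDiff fun q => (hbT q).1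
  · rw [hrange]
    exact (continuousOn_extChartAt x).isOpen_inter_preimage (isOpen_extChartAt_source x)
      (Metric.isOpen_ball.preimage L.continuous)
  · rintro _ ⟨q, rfl⟩
    exact (hbT q).2
  · have h0 : b 0 = L (φ x) := OpenPartialHomeomorph.univBall_apply_zero _ _
    dsimp only
    rw [h0, L.symm_apply_apply]
    exact extChartAt_to_inv x
  · rw [hrange]
    have h1 : ContMDiffOn 𝓘(ℝ, EuclideanSpace ℝ (Fin (Module.finrank ℝ E)))
        𝓘(ℝ, EuclideanSpace ℝ (Fin (Module.finrank ℝ E))) ∞ b.symm (Metric.ball (L (φ x)) r) :=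
      OpenPartialHomeomorph.contDiffOn_univBall_symm.contMDiffOn
    have h2 : ContMDiffOn I 𝓘(ℝ, E) ∞ φ φ.source := by
      rw [extChartAt_source]
      exact contMDiffOn_extChartAt
    exact h1.comp (L.contDiff.contMDiff.comp_contMDiffOn (h2.mono inter_subset_left))
      fun y hy => hy.2
  · intro q
    dsimp only
    rw [φ.right_inv (hbT q).1, L.apply_symm_apply, b.left_inv (hbs ▸ mem_univ q)]

/-! ### Regularity from derivatives along lines -/

section LineDerivative

variable {V : Type*} [NormedAddCommGroup V] [NormedSpace ℝ V]
  {F : V → ℂ} {A : V → V →L[ℝ] ℂ}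

theorem hasDerivAt_line (h : ∀ q w, HasDerivAt (fun t : ℝ => F (q + t • w)) (F q * A q w) 0)
    (q w : V) (t : ℝ) :
    HasDerivAt (fun t : ℝ => F (q + t • w)) (F (q + t • w) * A (q + t • w) w) t := by
  have h1 := (h (q + t • w) w).scomp_of_eq t ((hasDerivAt_id t).sub_const t) (by simp)
  rw [one_smul] at h1
  refine h1.congr_of_eventuallyEq (Filter.Eventually.of_forall fun s => ?_)
  simp only [Function.comp, id]
  rw [add_assoc, ← add_smul, add_sub_cancel]

/-- The mean value inequality for `t ↦ F (q + t • w) - t • B w` on `[0,1]`. -/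
theorem norm_line_sub_le {B : V →L[ℝ] ℂ} {C : ℝ} {q w : V}
    (h : ∀ q w, HasDerivAt (fun t : ℝ => F (q + t • w)) (F q * A q w) 0)
    (hC : ∀ t ∈ Icc (0 : ℝ) 1, ‖F (q + t • w) • A (q + t • w) - B‖ ≤ C) :
    ‖F (q + w) - F q - B w‖ ≤ C * ‖w‖ := by
  have h1 : ∀ t ∈ Icc (0 : ℝ) 1, HasDerivWithinAt (fun t : ℝ => F (q + t • w) - t • B w)
      (F (q + t • w) * A (q + t • w) w - B w) (Icc 0 1) t := fun t _ =>
    ((hasDerivAt_line h q w t).sub (by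
      simpa using (hasDerivAt_id t).smul_const (B w))).hasDerivWithinAt
  have h2 := norm_image_sub_le_of_norm_deriv_le_segment_01' h1 (C := C * ‖w‖) fun t ht =>
    ((F (q + t • w) • A (q + t • w) - B).le_opNorm w).trans
      (mul_le_mul_of_nonneg_right (hC t ⟨ht.1, ht.2.le⟩) (norm_nonneg w))
  simpa [sub_right_comm] using h2

/-- The mean value estimate is used twice. With `B = 0`, boundedness of `F` and local boundedness of
`A` give continuity of `F`. Then `F • A` is continuous, and `B = F q • A q` gives the Fréchet
derivative. -/
theorem hasFDerivAt_of_hasDerivAt_line (hA : Continuous A) (hF : ∀ q, ‖F q‖ ≤ 1)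
    (h : ∀ q w, HasDerivAt (fun t : ℝ => F (q + t • w)) (F q * A q w) 0) (q : V) :
    HasFDerivAt F (F q • A q) q := by
  have hsub : ∀ {x : V} {δ : ℝ} {y : V}, y ∈ Metric.ball x δ → ∀ t ∈ Icc (0 : ℝ) 1,
      x + t • (y - x) ∈ Metric.ball x δ := fun {x δ y} hy t ht =>
    (convex_ball x δ).add_smul_sub_mem
      (Metric.mem_ball_self (Metric.nonempty_ball.1 ⟨y, hy⟩)) hy ht
  have hcont : Continuous F := by
    rw [continuous_iff_continuousAt]
    intro x
    obtain ⟨δ, hδ, hball⟩ := Metric.continuousAt_iff.1 (hA.continuousAt (x := x)) 1 one_pos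
    refine continuousAt_of_locally_lipschitz hδ (‖A x‖ + 1) fun y hy => ?_
    have h1 := norm_line_sub_le (B := 0) (C := ‖A x‖ + 1) (q := x) (w := y - x) h fun t ht => by
      rw [sub_zero, norm_smul]
      have h2 := hball (hsub hy t ht)
      rw [dist_eq_norm] at h2
      have h3 := norm_le_norm_add_norm_sub' (A (x + t • (y - x))) (A x)
      have h4 := mul_le_mul_of_nonneg_right (hF (x + t • (y - x)))
        (norm_nonneg (A (x + t • (y - x))))
      linarith
    simpa [dist_eq_norm] using h1
  rw [hasFDerivAt_iff_isLittleO_nhds_zero, Asymptotics.isLittleO_iff]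
  intro ε hε
  obtain ⟨δ, hδ, hball⟩ := Metric.continuousAt_iff.1 ((hcont.smul hA).continuousAt (x := q)) ε hε
  filter_upwards [Metric.ball_mem_nhds (0 : V) hδ] with w hw
  refine norm_line_sub_le h fun t ht => ?_
  have h1 := hball (hsub (y := q + w) (by simpa using hw) t ht)
  rw [add_sub_cancel_left, dist_eq_norm] at h1
  exact h1.le

/-- A bounded solution of `dF = F A` along all lines, with `A` smooth, is smooth. -/
theorem contDiff_of_hasDerivAt_line (hA : ContDiff ℝ ∞ A) (hF : ∀ q, ‖F q‖ ≤ 1)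
    (h : ∀ q w, HasDerivAt (fun t : ℝ => F (q + t • w)) (F q * A q w) 0) : ContDiff ℝ ∞ F := by
  have hd := hasFDerivAt_of_hasDerivAt_line hA.continuous hF h
  rw [contDiff_infty]
  intro n
  induction n with
  | zero =>
    exact contDiff_zero.2 (continuous_iff_continuousAt.2 fun q => (hd q).continuousAt)
  | succ n ih =>
    -- Bootstrapping: if `F` is `C^n`, so is its derivative `F • A`.
    refine (contDiff_succ_iff_hasFDerivAt (n := n)).2
      ⟨fun q => F q • A q, ih.smul (hA.of_le (by exact_mod_cast le_top)), hd⟩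

end LineDerivative

/-! ### Local sections and pullbacks of forms -/

section LocalSection

variable {E : Type*} [NormedAddCommGroup E] [NormedSpace ℝ E]
  {H : Type*} [TopologicalSpace H] {I : ModelWithCorners ℝ E H}
  {M : Type*} [TopologicalSpace M] [ChartedSpace H M]
  {EP : Type*} [NormedAddCommGroup EP] [NormedSpace ℝ EP]
  {HP : Type*} [TopologicalSpace HP] {IP : ModelWithCorners ℝ EP HP}
  {P : Type*} [TopologicalSpace P] [ChartedSpace HP P]
  {p : P → M} {V : Type*} [NormedAddCommGroup V] [NormedSpace ℝ V]

theorem contMDiff_localSection {e : Bundle.Trivialization Circle p}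
    (he : ContMDiffOn (I.prod (𝓡 1)) IP ∞ e.toOpenPartialHomeomorph.symm e.target)
    {κ : V → M} (hκ : ContMDiff 𝓘(ℝ, V) I ∞ κ) (hκe : ∀ q, κ q ∈ e.baseSet) :
    ContMDiff 𝓘(ℝ, V) IP ∞ (fun q => e.toOpenPartialHomeomorph.symm (κ q, (1 : Circle))) :=
  he.comp_contMDiff (hκ.prodMk contMDiff_const) fun q => e.mem_target.2 (hκe q)

/-- The pullback of a `1`-form along a map from a vector space. -/
def pullbackForm (Ξ : (y : P) → TangentSpace IP y →L[ℝ] ℂ) (s : V → P) (q : V) : V →L[ℝ] ℂ :=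
  (Ξ (s q)).comp (mfderiv 𝓘(ℝ, V) IP s q)

variable {Ξ : (y : P) → TangentSpace IP y →L[ℝ] ℂ} {s : V → P}

theorem hasDerivAt_line_id (q w : V) (t : ℝ) : HasDerivAt (fun t : ℝ => q + t • w) w t := by
  simpa using ((hasDerivAt_id t).smul_const w).const_add q

theorem contMDiff_line (q w : V) {n : ℕ∞} :
    ContMDiff 𝓘(ℝ, ℝ) 𝓘(ℝ, V) n (fun t : ℝ => q + t • w) :=
  (contDiff_const.add (contDiff_id.smul contDiff_const)).contMDiff

theorem mfderiv_comp_line (hs : ContMDiff 𝓘(ℝ, V) IP ∞ s) (q w : V) (t : ℝ) :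
    (mfderiv 𝓘(ℝ, ℝ) IP (fun t : ℝ => s (q + t • w)) t (1 : ℝ) : EP) =
      mfderiv 𝓘(ℝ, V) IP s (q + t • w) w := by
  have h := mfderiv_comp_apply (I := 𝓘(ℝ, ℝ)) (I' := 𝓘(ℝ, V)) (I'' := IP) t
    (f := fun t : ℝ => q + t • w) (g := s) (hs.mdifferentiable (by simp) _)
    ((contMDiff_line q w (n := 1)).mdifferentiable (by simp) t) (1 : ℝ)
  refine h.trans ?_
  rw [mfderiv_eq_fderiv]
  have h2 : (fderiv ℝ (fun t : ℝ => q + t • w) t (1 : ℝ) : V) = w := by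
    rw [(hasDerivAt_line_id q w t).hasFDerivAt.fderiv]
    simp
  exact congrArg (fun v : V => (mfderiv 𝓘(ℝ, V) IP s (q + t • w) v : EP)) h2

theorem formAlong_line (hs : ContMDiff 𝓘(ℝ, V) IP ∞ s) (q w : V) (t : ℝ) :
    formAlong IP Ξ (fun t : ℝ => s (q + t • w)) t = pullbackForm Ξ s (q + t • w) w :=
  congrArg (Ξ (s (q + t • w))) (mfderiv_comp_line hs q w t)

/-- In finite dimension it suffices to test on a constant vector `w`, where the pullback is `Ξ`
composed with the tangent map of `s` and a constant vector field. -/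
theorem contDiff_pullbackForm [FiniteDimensional ℝ V] [IsManifold IP ∞ P] (hΞ : IsSmoothForm IP Ξ)
    (hs : ContMDiff 𝓘(ℝ, V) IP ∞ s) : ContDiff ℝ ∞ (pullbackForm Ξ s) := by
  rw [contDiff_clm_apply_iff]
  intro w
  have h1 : ContMDiff 𝓘(ℝ, V).tangent IP.tangent ∞ (tangentMap 𝓘(ℝ, V) IP s) :=
    hs.contMDiff_tangentMap (by simp)
  have h2 : ContMDiff 𝓘(ℝ, V) 𝓘(ℝ, V).tangent ∞
      (fun q : V => (⟨q, w⟩ : TangentBundle 𝓘(ℝ, V) V)) :=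
    (contMDiff_vectorSpace_iff_contDiff (V := fun _ : V => w)).2 contDiff_const
  exact (ContMDiff.comp hΞ (h1.comp h2)).contDiff

/-- Every tangent vector is the velocity of a smooth curve. -/
theorem exists_curve_mfderiv_eq [FiniteDimensional ℝ EP] [IsManifold IP ∞ P] [IP.Boundaryless]
    (y : P) (v : EP) :
    ∃ c : ℝ → P, ContMDiff 𝓘(ℝ, ℝ) IP ∞ c ∧ c 0 = y ∧
      (mfderiv 𝓘(ℝ, ℝ) IP c 0 (1 : ℝ) : EP) = v := by
  obtain ⟨κ, l, hκ, hκo, -, rfl, hl, hlκ⟩ := exists_parametrization IP isOpen_univ (mem_univ y)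
  obtain ⟨w, hw⟩ : ∃ w : EuclideanSpace ℝ (Fin (Module.finrank ℝ EP)),
      (mfderiv 𝓘(ℝ, EuclideanSpace ℝ (Fin (Module.finrank ℝ EP))) IP κ 0 w : EP) = v := by
    -- The vector `w` is the image of `v` under the differential of `l`: near `κ 0` the map `κ ∘ l`
    -- is the identity.
    have hld := ((hl _ ⟨0, rfl⟩).contMDiffAt (hκo.mem_nhds ⟨0, rfl⟩)).mdifferentiableAt
      (n := ∞) (by simp)
    have hκl : κ ∘ l =ᶠ[nhds (κ 0)] id := by
      filter_upwards [hκo.mem_nhds ⟨0, rfl⟩] with z hz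
      obtain ⟨q, rfl⟩ := hz
      rw [Function.comp, hlκ, id]
    have h1 := mfderiv_comp_apply_of_eq (I := IP) (I'' := IP) (κ 0) (f := l) (g := κ)
      (hκ.mdifferentiable (by simp) 0) hld (hlκ 0) v
    rw [hκl.mfderiv_eq, mfderiv_id] at h1
    exact ⟨_, h1.symm⟩
  have h0 : (0 : EuclideanSpace ℝ (Fin (Module.finrank ℝ EP))) + (0 : ℝ) • w = 0 := by simp
  refine ⟨fun t => κ (0 + t • w), hκ.comp (contMDiff_line (n := ⊤) _ _), congrArg κ h0, ?_⟩
  exact (mfderiv_comp_line hκ _ _ _).trans ((congrArg (fun q => (mfderiv 𝓘(ℝ,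
    EuclideanSpace ℝ (Fin (Module.finrank ℝ EP))) IP κ q w : EP)) h0).trans hw)

end LocalSection

/-! ### Smoothness of maps that commute with parallel transport -/

section Transport

variable {M : Type*}
  {EP : Type*} [NormedAddCommGroup EP] [NormedSpace ℝ EP]
  {HP : Type*} [TopologicalSpace HP] (IP : ModelWithCorners ℝ EP HP)
  {P : Type*} [TopologicalSpace P] [ChartedSpace HP P] [MulAction Circle P]
  (p : P → M) (Ξ : (y : P) → TangentSpace IP y →L[ℝ] ℂ)
  {EP' : Type*} [NormedAddCommGroup EP'] [NormedSpace ℝ EP']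
  {HP' : Type*} [TopologicalSpace HP'] (IP' : ModelWithCorners ℝ EP' HP')
  {P' : Type*} [TopologicalSpace P'] [ChartedSpace HP' P'] [MulAction Circle P']
  (p' : P' → M) (Ξ' : (y : P') → TangentSpace IP' y →L[ℝ] ℂ)

/-- A `U(1)`-equivariant map over the identity of the base, not assumed to be continuous, that
commutes with parallel transport. -/
structure CommutesWithTransport (Φ : P' → P) : Prop where
  proj_eq : ∀ y, p (Φ y) = p' y
  map_smul : ∀ (u : Circle) y, Φ (u • y) = u • Φ y
  map_horizontal : ∀ (α : ℝ → P') (β : ℝ → P), IsHorizontalCurve IP' Ξ' α →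
    IsHorizontalCurve IP Ξ β → (∀ t, p' (α t) = p (β t)) → Φ (α 0) = β 0 → ∀ t, Φ (α t) = β t

variable {IP p Ξ IP' p' Ξ'}

namespace CommutesWithTransport

theorem symm {Φ : P' ≃ P} (h : CommutesWithTransport IP p Ξ IP' p' Ξ' Φ) :
    CommutesWithTransport IP' p' Ξ' IP p Ξ Φ.symm where
  proj_eq y := by rw [← h.proj_eq, Φ.apply_symm_apply]
  map_smul u y := by rw [Φ.symm_apply_eq, h.map_smul, Φ.apply_symm_apply]
  map_horizontal α β hα hβ hp h0 t := by
    rw [Φ.symm_apply_eq] at h0 ⊢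
    exact (h.map_horizontal β α hβ hα (fun t => (hp t).symm) h0.symm t).symm

variable {E : Type*} [NormedAddCommGroup E] [NormedSpace ℝ E]
  {H : Type*} [TopologicalSpace H] {I : ModelWithCorners ℝ E H}
  [TopologicalSpace M] [ChartedSpace H M]
  [IsManifold IP ∞ P] [IsManifold IP' ∞ P'] {Φ : P' → P}

/-- No regularity of `Φ` is needed: after rotation by `θ'` and `θ` both curves are horizontal, and
`Φ` carries one to a constant multiple `w` of the other. Hence `v = w · exp (i (θ - θ'))`, whose
derivative is known. -/
theorem hasDerivAt (hP : IsPrincipalCircleBundle I IP p) (hΞ : IsConnectionForm IP Ξ)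
    (hP' : IsPrincipalCircleBundle I IP' p') (hΞ' : IsConnectionForm IP' Ξ')
    (h : CommutesWithTransport IP p Ξ IP' p' Ξ' Φ) {c' : ℝ → P'} {c : ℝ → P} {v : ℝ → Circle}
    (hc' : ContMDiff 𝓘(ℝ, ℝ) IP' 1 c') (hc : ContMDiff 𝓘(ℝ, ℝ) IP 1 c)
    (hv : ∀ t, Φ (c' t) = v t • c t) (t : ℝ) :
    HasDerivAt (fun t => (v t : ℂ)) (v t * (formAlong IP' Ξ' c' t - formAlong IP Ξ c t)) t := by
  obtain ⟨θ', hθ', h1', h2'⟩ := hP'.exists_gauge_horizontal hΞ' hc'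
  obtain ⟨θ, hθ, h1, h2⟩ := hP.exists_gauge_horizontal hΞ hc
  -- The constant that makes the two horizontal curves correspond under `Φ` at time `0`.
  obtain ⟨w, hw⟩ : ∃ w : Circle, w * Circle.exp (θ 0) = Circle.exp (θ' 0) * v 0 :=
    ⟨Circle.exp (θ' 0) * v 0 * (Circle.exp (θ 0))⁻¹, by rw [inv_mul_cancel_right]⟩
  have key := h.map_horizontal (fun t => Circle.exp (θ' t) • c' t)
    (fun t => w • (Circle.exp (θ t) • c t)) ⟨h1', h2'⟩
    (IsHorizontalCurve.smul hΞ (hP.contMDiff_const_smul w) ⟨h1, h2⟩)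
    (fun t => by
      rw [hP.proj_smul, hP.proj_smul, hP'.proj_smul, ← h.proj_eq, hv, hP.proj_smul])
    (by rw [h.map_smul, hv, smul_smul, smul_smul, hw])
  have hvt : ∀ t, v t = w * Circle.exp (θ t - θ' t) := fun t => by
    have h3 := key t
    rw [h.map_smul, hv, smul_smul, smul_smul] at h3
    rw [Circle.exp_sub, ← mul_div_assoc, ← hP.smul_left_injective h3, mul_div_cancel_left]
  have h4 := (hasDerivAt_coe_circleExp ((hθ t).sub (hθ' t))).const_mul (w : ℂ)
  have h5 : (fun t => (v t : ℂ)) = fun t => (w : ℂ) * (Circle.exp ((θ - θ') t) : ℂ) :=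
    funext fun t => by rw [hvt t, Circle.coe_mul]; rfl
  have h6 : (formAlong IP Ξ c t).re = 0 := hΞ.imaginary _ _
  have h6' : (formAlong IP' Ξ' c' t).re = 0 := hΞ'.imaginary _ _
  have h7 : formAlong IP' Ξ' c' t - formAlong IP Ξ c t =
      ((-(formAlong IP Ξ c t).im - -(formAlong IP' Ξ' c' t).im : ℝ) : ℂ) * Complex.I := by
    apply Complex.ext
    · simp [h6, h6']
    · simp
      ring
  rw [h7, h5, hvt t, Circle.coe_mul, mul_assoc]
  exact h4

/-- In local sections `Φ` is given by `Φ (s' q) = F q • s q`, and `hasDerivAt` along lines is the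
differential equation that forces `F` to be smooth. -/
theorem contMDiff [FiniteDimensional ℝ E] [I.Boundaryless] [IsManifold I ∞ M]
    (hP : IsPrincipalCircleBundle I IP p) (hΞ : IsConnectionForm IP Ξ)
    (hP' : IsPrincipalCircleBundle I IP' p') (hΞ' : IsConnectionForm IP' Ξ')
    (h : CommutesWithTransport IP p Ξ IP' p' Ξ' Φ) : ContMDiff IP' IP ∞ Φ := by
  intro y₀
  obtain ⟨e, hx, -, hes, he⟩ := hP.exists_trivialization (p' y₀)
  obtain ⟨e', hx', he', hes', hesmul'⟩ := hP'.exists_trivialization (p' y₀)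
  obtain ⟨κ, l, hκ, hκo, hκW, hκ0, hl, hlκ⟩ :=
    exists_parametrization I (e.open_baseSet.inter e'.open_baseSet) ⟨hx, hx'⟩
  have hκe : ∀ q, κ q ∈ e.baseSet := fun q => (hκW ⟨q, rfl⟩).1
  have hκe' : ∀ q, κ q ∈ e'.baseSet := fun q => (hκW ⟨q, rfl⟩).2
  have hs := contMDiff_localSection hes hκ hκe
  have hs' := contMDiff_localSection hes' hκ hκe'
  set s := fun q => e.toOpenPartialHomeomorph.symm (κ q, (1 : Circle)) with hsdef
  set s' := fun q => e'.toOpenPartialHomeomorph.symm (κ q, (1 : Circle)) with hsdef'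
  have hps : ∀ q, p (s q) = κ q := fun q => e.proj_symm_apply' (hκe q)
  have hps' : ∀ q, p' (s' q) = κ q := fun q => e'.proj_symm_apply' (hκe' q)
  have hF : ∀ q, ∃ u : Circle, Φ (s' q) = u • s q := fun q =>
    hP.exists_smul_eq (by rw [hps, h.proj_eq, hps'])
  choose F hF using hF
  have hFs : ContDiff ℝ ∞ (fun q => (F q : ℂ)) := by
    refine contDiff_of_hasDerivAt_line (A := fun q => pullbackForm Ξ' s' q - pullbackForm Ξ s q)
      ((contDiff_pullbackForm hΞ'.smooth hs').sub (contDiff_pullbackForm hΞ.smooth hs))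
      (fun q => (Circle.norm_coe _).le) fun q w => ?_
    have h1 := h.hasDerivAt hP hΞ hP' hΞ' (c' := fun t : ℝ => s' (q + t • w))
      (c := fun t : ℝ => s (q + t • w)) (v := fun t => F (q + t • w))
      ((hs'.of_le (by simp)).comp (contMDiff_line q w))
      ((hs.of_le (by simp)).comp (contMDiff_line q w)) (fun t => hF _) 0
    rw [formAlong_line hs, formAlong_line hs', zero_smul, add_zero] at h1
    exact h1
  have hFc : ContMDiff _ (𝓡 1) ∞ F := contMDiff_circle_of_coe hFs.contMDiff
  have hU : IsOpen (p' ⁻¹' range κ) := hκo.preimage hP'.contMDiff_proj.continuous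
  have hy₀ : y₀ ∈ p' ⁻¹' range κ := ⟨0, hκ0⟩
  have hsub : p' ⁻¹' range κ ⊆ e'.source := fun y hy => e'.mem_source.2 (hκW hy).2
  -- By equivariance `F` determines `Φ` on the whole fibre, and this formula is visibly smooth in
  -- `y`.
  have hΦ : ∀ y ∈ p' ⁻¹' range κ, Φ y = (e' y).2 • (F (l (p' y)) • s (l (p' y))) := by
    rintro y ⟨q, hq⟩
    have h1 : y = (e' y).2 • s' q := by
      have h2 : s' q ∈ e'.source := e'.mem_source.2 (by rw [hps']; exact hκe' q)
      have h3 : e' (s' q) = (κ q, 1) := e'.apply_symm_apply' (hκe' q)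
      refine e'.injOn (hsub ⟨q, hq⟩) (e'.mem_source.2 (by rw [hP'.proj_smul, hps']; exact hκe' q)) ?_
      refine Prod.ext ?_ ?_
      · change (e' y).1 = (e' _).1
        rw [e'.coe_fst (hsub ⟨q, hq⟩), e'.coe_fst, hP'.proj_smul, hps', hq]
        exact e'.mem_source.2 (by rw [hP'.proj_smul, hps']; exact hκe' q)
      · change (e' y).2 = (e' _).2
        rw [hesmul' _ h2, h3, one_mul]
    rw [← hq, hlκ, ← hF, ← h.map_smul, ← h1]
  have hlp : ContMDiffOn IP' _ ∞ (fun y => l (p' y)) (p' ⁻¹' range κ) :=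
    hl.comp hP'.contMDiff_proj.contMDiffOn fun _ hy => hy
  refine (ContMDiffOn.congr ?_ hΦ).contMDiffAt (hU.mem_nhds hy₀)
  exact hP.contMDiff_smul.comp_contMDiffOn ((contMDiff_snd.comp_contMDiffOn (he'.mono hsub)).prodMk
    (hP.contMDiff_smul.comp_contMDiffOn ((hFc.comp_contMDiffOn hlp).prodMk
      (hs.comp_contMDiffOn hlp))))

/-- Take a curve `c` with velocity `v`. The ratio of `Φ ∘ c` to itself is constantly `1`, so its
derivative, the difference of the two forms, vanishes. -/
theorem pullback_form_eq [FiniteDimensional ℝ E] [I.Boundaryless] [IsManifold I ∞ M]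
    [FiniteDimensional ℝ EP'] [IP'.Boundaryless]
    (hP : IsPrincipalCircleBundle I IP p) (hΞ : IsConnectionForm IP Ξ)
    (hP' : IsPrincipalCircleBundle I IP' p') (hΞ' : IsConnectionForm IP' Ξ')
    (h : CommutesWithTransport IP p Ξ IP' p' Ξ' Φ) (y : P') (v : TangentSpace IP' y) :
    Ξ (Φ y) (mfderiv IP' IP Φ y v) = Ξ' y v := by
  obtain ⟨c, hc, rfl, rfl⟩ := exists_curve_mfderiv_eq (IP := IP') y v
  have hΦ := h.contMDiff hP hΞ hP' hΞ'
  have h1 := h.hasDerivAt hP hΞ hP' hΞ' (c' := c) (c := fun t => Φ (c t)) (v := fun _ => 1)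
    (hc.of_le (by simp)) ((hΦ.comp hc).of_le (by simp)) (fun t => by rw [one_smul]) 0
  have h2 := h1.unique (hasDerivAt_const 0 _)
  rw [Circle.coe_one, one_mul, sub_eq_zero] at h2
  have h3 := mfderiv_comp_apply (I := 𝓘(ℝ, ℝ)) (I' := IP') (I'' := IP) 0
    (hΦ.mdifferentiable (by simp) _) (hc.mdifferentiable (by simp) 0) (1 : ℝ)
  exact (congrArg (Ξ (Φ (c 0))) h3).symm.trans h2.symm

end CommutesWithTransport
end Transport

/-! ### Construction of the isomorphism from equal holonomies -/

section Construction

variable {E : Type*} [NormedAddCommGroup E] [NormedSpace ℝ E]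
  {H : Type*} [TopologicalSpace H] {I : ModelWithCorners ℝ E H}
  {M : Type*} [TopologicalSpace M] [ChartedSpace H M]
  {EP : Type*} [NormedAddCommGroup EP] [NormedSpace ℝ EP]
  {HP : Type*} [TopologicalSpace HP] {IP : ModelWithCorners ℝ EP HP}
  {P : Type*} [TopologicalSpace P] [ChartedSpace HP P] [MulAction Circle P]
  {p : P → M} {Ξ : (y : P) → TangentSpace IP y →L[ℝ] ℂ}
  {EP' : Type*} [NormedAddCommGroup EP'] [NormedSpace ℝ EP']
  {HP' : Type*} [TopologicalSpace HP'] {IP' : ModelWithCorners ℝ EP' HP'}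
  {P' : Type*} [TopologicalSpace P'] [ChartedSpace HP' P'] [MulAction Circle P']
  {p' : P' → M} {Ξ' : (y : P') → TangentSpace IP' y →L[ℝ] ℂ}

theorem bijective_of_map_smul (hP : IsPrincipalCircleBundle I IP p)
    (hP' : IsPrincipalCircleBundle I IP' p') {Φ : P' → P} (hp : ∀ y, p (Φ y) = p' y)
    (hΦ : ∀ (u : Circle) y, Φ (u • y) = u • Φ y) : Function.Bijective Φ := by
  constructor
  · intro y z h
    obtain ⟨u, rfl⟩ := hP'.exists_smul_eq (y := y) (z := z) (by rw [← hp, ← hp, h])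
    rw [hΦ] at h
    rw [← hP.smul_left_injective ((one_smul Circle (Φ y)).trans h), one_smul]
  · intro z
    obtain ⟨y, hy⟩ := hP'.surjective (p z)
    obtain ⟨u, rfl⟩ := hP.exists_smul_eq (y := Φ y) (z := z) (by rw [hp, hy])
    exact ⟨u • y, hΦ u y⟩

variable [IsManifold IP ∞ P] [IsManifold IP' ∞ P']

/-- The points over a coordinate neighbourhood are reachable from each other. -/
theorem exists_isOpen_horizontalStep [FiniteDimensional ℝ E] [I.Boundaryless] [IsManifold I ∞ M]
    (hP : IsPrincipalCircleBundle I IP p) (hΞ : IsConnectionForm IP Ξ)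
    (hP' : IsPrincipalCircleBundle I IP' p') (hΞ' : IsConnectionForm IP' Ξ') (x : M) :
    ∃ U : Set M, IsOpen U ∧ x ∈ U ∧ ∀ (a : P') (b : P), p' a = p b → p' a ∈ U → ∀ x' ∈ U,
      ∃ a' b', HorizontalStep IP p Ξ IP' p' Ξ' (a, b) (a', b') ∧ p' a' = x' := by
  obtain ⟨e, hx, -, hes, -⟩ := hP.exists_trivialization x
  obtain ⟨e', hx', -, hes', -⟩ := hP'.exists_trivialization x
  obtain ⟨κ, l, hκ, hκo, hκW, hκ0, -, -⟩ :=
    exists_parametrization I (e.open_baseSet.inter e'.open_baseSet) ⟨hx, hx'⟩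
  have hκe : ∀ q, κ q ∈ e.baseSet := fun q => (hκW ⟨q, rfl⟩).1
  have hκe' : ∀ q, κ q ∈ e'.baseSet := fun q => (hκW ⟨q, rfl⟩).2
  have hs := contMDiff_localSection hes hκ hκe
  have hs' := contMDiff_localSection hes' hκ hκe'
  refine ⟨range κ, hκo, ⟨0, hκ0⟩, ?_⟩
  rintro a b hab ⟨q, hq⟩ _ ⟨q', rfl⟩
  -- The segment from `q` to `q'` is lifted by the local sections and made horizontal; constant
  -- rotations then move the initial points to `a` and `b`.
  obtain ⟨θ, -, h1⟩ := hP.exists_gauge_horizontal hΞ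
    ((hs.of_le (by simp)).comp (contMDiff_line q (q' - q)))
  obtain ⟨θ', -, h1'⟩ := hP'.exists_gauge_horizontal hΞ'
    ((hs'.of_le (by simp)).comp (contMDiff_line q (q' - q)))
  have hpr : ∀ t, p (Circle.exp (θ t) • e.toOpenPartialHomeomorph.symm
      (κ (q + t • (q' - q)), (1 : Circle))) = κ (q + t • (q' - q)) := fun t => by
    rw [hP.proj_smul]
    exact e.proj_symm_apply' (hκe _)
  have hpr' : ∀ t, p' (Circle.exp (θ' t) • e'.toOpenPartialHomeomorph.symm
      (κ (q + t • (q' - q)), (1 : Circle))) = κ (q + t • (q' - q)) := fun t => by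
    rw [hP'.proj_smul]
    exact e'.proj_symm_apply' (hκe' _)
  obtain ⟨u, rfl⟩ := hP.exists_smul_eq (z := b) ((hpr 0).trans (by simp [hq, hab]))
  obtain ⟨u', rfl⟩ := hP'.exists_smul_eq (z := a) ((hpr' 0).trans (by simp [hq]))
  refine ⟨_, _, ⟨_, _, IsHorizontalCurve.smul hΞ' (hP'.contMDiff_const_smul u') ⟨h1'.1, h1'.2⟩,
    IsHorizontalCurve.smul hΞ (hP.contMDiff_const_smul u) ⟨h1.1, h1.2⟩, fun t => ?_, rfl, rfl⟩, ?_⟩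
  · exact (hP'.proj_smul _ _).trans ((hpr' t).trans ((hP.proj_smul _ _).trans (hpr t)).symm)
  · exact (hP'.proj_smul _ _).trans ((hpr' 1).trans (by simp))

/-- A coordinate neighbourhood that meets the set of reachable base points lies inside it. So this
set is clopen, and `M` is connected. -/
theorem exists_horizontalReach [FiniteDimensional ℝ E] [I.Boundaryless] [IsManifold I ∞ M]
    [ConnectedSpace M]
    (hP : IsPrincipalCircleBundle I IP p) (hΞ : IsConnectionForm IP Ξ)
    (hP' : IsPrincipalCircleBundle I IP' p') (hΞ' : IsConnectionForm IP' Ξ')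
    {a₀ : P'} {b₀ : P} (h₀ : p' a₀ = p b₀) (x : M) :
    ∃ a b, HorizontalReach IP p Ξ IP' p' Ξ' (a₀, b₀) (a, b) ∧ p' a = x := by
  set S : Set M := {x | ∃ a b, HorizontalReach IP p Ξ IP' p' Ξ' (a₀, b₀) (a, b) ∧ p' a = x}
  have hloc : ∀ x : M, ∃ U : Set M, IsOpen U ∧ x ∈ U ∧
      ∀ x₁ ∈ U, x₁ ∈ S → ∀ x₂ ∈ U, x₂ ∈ S := fun x => by
    obtain ⟨U, hU, hxU, h⟩ := exists_isOpen_horizontalStep hP hΞ hP' hΞ' x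
    refine ⟨U, hU, hxU, ?_⟩
    rintro _ hx₁ ⟨a, b, hab, rfl⟩ x₂ hx₂
    obtain ⟨a', b', hstep, ha'⟩ := h a b (hab.proj_eq h₀) hx₁ x₂ hx₂
    exact ⟨a', b', hab.tail hstep, ha'⟩
  have hS : IsClopen S := by
    constructor
    · rw [← isOpen_compl_iff, isOpen_iff_forall_mem_open]
      intro x hx
      obtain ⟨U, hU, hxU, h⟩ := hloc x
      exact ⟨U, fun z hz hzS => hx (h z hz hzS x hxU), hU, hxU⟩
    · rw [isOpen_iff_forall_mem_open]
      intro x hx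
      obtain ⟨U, hU, hxU, h⟩ := hloc x
      exact ⟨U, h x hxU hx, hU, hxU⟩
  have huniv : S = univ := hS.eq_univ ⟨p' a₀, a₀, b₀, Relation.ReflTransGen.refl, rfl⟩
  exact (huniv.symm ▸ mem_univ x : x ∈ S)

/-- Equality of holonomies gives an equivariant identification commuting with parallel transport. -/
theorem exists_commutesWithTransport [FiniteDimensional ℝ E] [I.Boundaryless] [IsManifold I ∞ M]
    [ConnectedSpace M] {EG : Type*} [NormedAddCommGroup EG] [NormedSpace ℝ EG]
    {HG : Type*} [TopologicalSpace HG] {IG : ModelWithCorners ℝ EG HG}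
    {G : Type*} [Group G] [TopologicalSpace G] [ChartedSpace HG G]
    [MulAction G M] [MulAction G P] [MulAction G P']
    (hP : IsEquivariantCircleBundle I IP IG G p) (hΞ : IsConnectionForm IP Ξ)
    (hP' : IsEquivariantCircleBundle I IP' IG G p') (hΞ' : IsConnectionForm IP' Ξ')
    (hol : ∀ (φ : G), ∀ γ ∈ twistedLoops I φ,
      equivariantHolonomy IP p Ξ φ γ = equivariantHolonomy IP' p' Ξ' φ γ) :
    ∃ Φ : P' ≃ P, CommutesWithTransport IP p Ξ IP' p' Ξ' Φ ∧
      ∀ (g : G) y, Φ (g • y) = g • Φ y := by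
  have hB := hP.toIsPrincipalCircleBundle
  have hB' := hP'.toIsPrincipalCircleBundle
  obtain ⟨x₀⟩ := (inferInstance : Nonempty M)
  obtain ⟨b₀, hb₀⟩ := hB.surjective x₀
  obtain ⟨a₀, ha₀⟩ := hB'.surjective x₀
  have h₀ : p' a₀ = p b₀ := ha₀.trans hb₀.symm
  -- The graph of `Φ`. The rotation `w` is needed because transport from `a₀` need not reach every
  -- point of a fibre.
  let R : P' → P → Prop := fun a b =>
    ∃ w : Circle, HorizontalReach IP p Ξ IP' p' Ξ' (a₀, b₀) (w • a, w • b)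
  have hRproj : ∀ {a b}, R a b → p b = p' a := fun {a b} ⟨w, hw⟩ => by
    have := hw.proj_eq h₀
    rwa [hB'.proj_smul, hB.proj_smul, eq_comm] at this
  have hRG : ∀ {a b d} {g : G}, R a b → R (g • a) d → d = g • b := by
    rintro a b d g ⟨w, hw⟩ ⟨v, hv⟩
    -- Back from `(w • a, w • b)` to the initial pair, then out to `(v • g • a, v • d)`: in `P'`
    -- this closes up to `g` and `v * w⁻¹`.
    have h1 := hw.symm.trans hv
    have h2 : v • (g • a) = (v * w⁻¹) • (g • (w • a)) := by
      rw [hP'.smul_comm, smul_smul, inv_mul_cancel_right]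
    rw [h2] at h1
    have h3 := HorizontalReach.eq_smul hP hΞ hP' hΞ' hol (hw.proj_eq h₀) h1
    rw [hP.smul_comm, smul_smul, inv_mul_cancel_right] at h3
    exact smul_left_cancel v h3
  -- Single-valuedness is equivariance for `g = 1`.
  have hRuniq : ∀ {a b d}, R a b → R a d → d = b := fun {a b d} h1 h2 => by
    have h3 := hRG (g := (1 : G)) h1 (by rwa [one_smul])
    rwa [one_smul] at h3
  have hRsmul : ∀ {a b} (u : Circle), R a b → R (u • a) (u • b) := by
    rintro a b u ⟨w, hw⟩
    refine ⟨w * u⁻¹, ?_⟩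
    rwa [smul_smul, smul_smul, inv_mul_cancel_right]
  have hRex : ∀ a, ∃ b, R a b := fun a => by
    obtain ⟨a', b', h, ha'⟩ := exists_horizontalReach hB hΞ hB' hΞ' h₀ (p' a)
    obtain ⟨u, rfl⟩ := hB'.exists_smul_eq ha'.symm
    exact ⟨u⁻¹ • b', u, by rwa [smul_inv_smul]⟩
  choose Φ hΦ using hRex
  have hΦ_eq : ∀ {a b}, R a b → Φ a = b := fun h => hRuniq h (hΦ _)
  have hsmul : ∀ (u : Circle) y, Φ (u • y) = u • Φ y := fun u y => hΦ_eq (hRsmul u (hΦ y))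
  refine ⟨Equiv.ofBijective Φ (bijective_of_map_smul hB hB' (fun y => hRproj (hΦ y)) hsmul),
    ⟨fun y => hRproj (hΦ y), hsmul, ?_⟩, fun g y => hRG (hΦ y) (hΦ (g • y))⟩
  intro α β hα hβ hp h0 t
  refine hΦ_eq ?_
  obtain ⟨w, hw⟩ : R (α 0) (β 0) := h0 ▸ hΦ (α 0)
  have hstep : HorizontalReach IP p Ξ IP' p' Ξ' (α 0, β 0) (α t, β t) :=
    Relation.ReflTransGen.single (HorizontalStep.of_curves hα hβ hp 0 t)
  exact ⟨w, hw.trans (hstep.smul hB hΞ hB' hΞ' w)⟩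

end Construction

/-! ### Isomorphisms preserve holonomy -/

section Isomorphism

variable {M : Type*}
  {EP : Type*} [NormedAddCommGroup EP] [NormedSpace ℝ EP]
  {HP : Type*} [TopologicalSpace HP] {IP : ModelWithCorners ℝ EP HP}
  {P : Type*} [TopologicalSpace P] [ChartedSpace HP P]
  {p : P → M} {Ξ : (y : P) → TangentSpace IP y →L[ℝ] ℂ}
  {EP' : Type*} [NormedAddCommGroup EP'] [NormedSpace ℝ EP']
  {HP' : Type*} [TopologicalSpace HP'] {IP' : ModelWithCorners ℝ EP' HP'}
  {P' : Type*} [TopologicalSpace P'] [ChartedSpace HP' P']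
  {p' : P' → M} {Ξ' : (y : P') → TangentSpace IP' y →L[ℝ] ℂ}

theorem IsHorizontalLift.map_diffeomorph (Φ : P' ≃ₘ^∞⟮IP', IP⟯ P) (hp : ∀ y, p (Φ y) = p' y)
    (hΦ : ∀ (y : P') (v : TangentSpace IP' y), Ξ (Φ y) (mfderiv IP' IP Φ y v) = Ξ' y v)
    {γ : ℝ → M} {c : ℝ → P'} (hc : IsHorizontalLift IP' p' Ξ' γ c) :
    IsHorizontalLift IP p Ξ γ (fun t => Φ (c t)) where
  piecewiseC1 := hc.piecewiseC1.contMDiff_comp (Φ.contMDiff.of_le (by simp))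
  proj_eq t ht := by rw [hp, hc.proj_eq t ht]
  horizontal t ht hd := by
    have hd' : MDifferentiableAt 𝓘(ℝ, ℝ) IP' c t := by
      have h1 := (Φ.symm.contMDiff.mdifferentiable (by simp) _).comp t hd
      refine h1.congr_of_eventuallyEq (Filter.Eventually.of_forall fun s => ?_)
      exact (Φ.symm_apply_apply _).symm
    have h2 := mfderiv_comp_apply (I := 𝓘(ℝ, ℝ)) (I' := IP') (I'' := IP) t
      (Φ.contMDiff.mdifferentiable (by simp) _) hd' (1 : ℝ)
    exact (congrArg (Ξ (Φ (c t))) h2).trans ((hΦ _ _).trans (hc.horizontal t ht hd'))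

theorem symm_pullback_eq (Φ : P' ≃ₘ^∞⟮IP', IP⟯ P)
    (hΦ : ∀ (y : P') (v : TangentSpace IP' y), Ξ (Φ y) (mfderiv IP' IP Φ y v) = Ξ' y v)
    (y : P) (v : TangentSpace IP y) :
    Ξ' (Φ.symm y) (mfderiv IP IP' Φ.symm y v) = Ξ y v := by
  rw [← hΦ]
  have h := mfderiv_comp_apply (I := IP) (I' := IP') (I'' := IP) y
    (Φ.contMDiff.mdifferentiable (by simp) _) (Φ.symm.contMDiff.mdifferentiable (by simp) y) v
  have h1 : Φ ∘ Φ.symm = id := funext Φ.apply_symm_apply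
  rw [h1, mfderiv_id] at h
  exact (congrArg (Ξ (Φ (Φ.symm y))) h.symm).trans (form_congr (IP := IP) (Ξ := Ξ) (Φ.apply_symm_apply y) v)

/-- `Φ` matches the horizontal lifts on both sides, so the two predicates under `epsilon` coincide.
Hence the equality holds for every `γ`, without existence or uniqueness of lifts. -/
theorem EquivariantlyIsomorphic.equivariantHolonomy_eq [MulAction Circle P] [MulAction Circle P']
    {G : Type*} [Group G] [MulAction G P] [MulAction G P']
    (h : EquivariantlyIsomorphic IP IP' G p Ξ p' Ξ') (φ : G) (γ : ℝ → M) :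
    equivariantHolonomy IP p Ξ φ γ = equivariantHolonomy IP' p' Ξ' φ γ := by
  obtain ⟨Φ, hp, hc, hg, hΦ⟩ := h
  unfold equivariantHolonomy
  congr 1
  funext u
  refine propext ⟨?_, ?_⟩
  · rintro ⟨c, hl, h1⟩
    refine ⟨fun t => Φ.symm (c t), hl.map_diffeomorph Φ.symm
      (fun y => by rw [← hp, Φ.apply_symm_apply]) (symm_pullback_eq Φ hΦ), ?_⟩
    apply Φ.injective
    change Φ _ = Φ _
    rw [hc, hg, Φ.apply_symm_apply, Φ.apply_symm_apply, h1]
  · rintro ⟨c, hl, h1⟩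
    refine ⟨fun t => Φ (c t), hl.map_diffeomorph Φ hp hΦ, ?_⟩
    dsimp only
    rw [h1, hc, hg]

end Isomorphism

end EquivariantHolonomy

end

theorem mainTheorem1
    -- the Lie group `G`
    {EG : Type*} [NormedAddCommGroup EG] [NormedSpace ℝ EG] [FiniteDimensional ℝ EG]
    {HG : Type*} [TopologicalSpace HG] (IG : ModelWithCorners ℝ EG HG) [IG.Boundaryless]
    {G : Type*} [Group G] [TopologicalSpace G] [ChartedSpace HG G] [LieGroup IG ∞ G]
    -- the connected manifold `M` with its action of `G`
    {E : Type*} [NormedAddCommGroup E] [NormedSpace ℝ E] [FiniteDimensional ℝ E]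
    {H : Type*} [TopologicalSpace H] (I : ModelWithCorners ℝ E H) [I.Boundaryless]
    {M : Type*} [TopologicalSpace M] [ChartedSpace H M] [IsManifold I ∞ M] [ConnectedSpace M]
    [MulAction G M] [ContMDiffSMul IG I ∞ G M]
    -- the bundle with connection `(P, Ξ)`
    {EP : Type*} [NormedAddCommGroup EP] [NormedSpace ℝ EP] [FiniteDimensional ℝ EP]
    {HP : Type*} [TopologicalSpace HP] (IP : ModelWithCorners ℝ EP HP) [IP.Boundaryless]
    {P : Type*} [TopologicalSpace P] [ChartedSpace HP P] [IsManifold IP ∞ P]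
    [MulAction Circle P] [MulAction G P] (p : P → M)
    (hP : EquivariantHolonomy.IsEquivariantCircleBundle I IP IG G p)
    (Ξ : (y : P) → TangentSpace IP y →L[ℝ] ℂ)
    (hΞ : EquivariantHolonomy.IsInvariantConnectionForm IP G Ξ)
    -- the bundle with connection `(P', Ξ')`
    {EP' : Type*} [NormedAddCommGroup EP'] [NormedSpace ℝ EP'] [FiniteDimensional ℝ EP']
    {HP' : Type*} [TopologicalSpace HP'] (IP' : ModelWithCorners ℝ EP' HP') [IP'.Boundaryless]
    {P' : Type*} [TopologicalSpace P'] [ChartedSpace HP' P'] [IsManifold IP' ∞ P']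
    [MulAction Circle P'] [MulAction G P'] (p' : P' → M)
    (hP' : EquivariantHolonomy.IsEquivariantCircleBundle I IP' IG G p')
    (Ξ' : (y : P') → TangentSpace IP' y →L[ℝ] ℂ)
    (hΞ' : EquivariantHolonomy.IsInvariantConnectionForm IP' G Ξ') :
    EquivariantHolonomy.EquivariantlyIsomorphic IP IP' G p Ξ p' Ξ' ↔
      ∀ (φ : G), ∀ γ ∈ EquivariantHolonomy.twistedLoops I φ,
        EquivariantHolonomy.equivariantHolonomy IP p Ξ φ γ =
          EquivariantHolonomy.equivariantHolonomy IP' p' Ξ' φ γ := by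
  constructor
  · exact fun h φ γ _ => h.equivariantHolonomy_eq φ γ
  · intro hol
    obtain ⟨Φ, hΦ, hg⟩ := EquivariantHolonomy.exists_commutesWithTransport hP
      hΞ.toIsConnectionForm hP' hΞ'.toIsConnectionForm hol
    have hB := hP.toIsPrincipalCircleBundle
    have hB' := hP'.toIsPrincipalCircleBundle
    -- The inverse of `Φ` also commutes with transport, so it is smooth for the same reason.
    exact ⟨⟨Φ, hΦ.contMDiff hB hΞ.toIsConnectionForm hB' hΞ'.toIsConnectionForm,
      hΦ.symm.contMDiff hB' hΞ'.toIsConnectionForm hB hΞ.toIsConnectionForm⟩,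
      hΦ.proj_eq, hΦ.map_smul, hg,
      hΦ.pullback_form_eq hB hΞ.toIsConnectionForm hB' hΞ'.toIsConnectionForm⟩
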